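/- Let $\hat K=[0,1]^2$, let $k\ge 1$ be an integer, let $P_m$ be the space of real polynomials in $(x,y)$ of total degree at most $m$ (with $P_{-1}=\{0\}$), and let $$BDM_k=(P_k)^2\oplus\operatorname{span}\{\operatorname{curl}(x^{k+1}y),\ \operatorname{curl}(xy^{k+1})\},\qquad \operatorname{curl}q=(\partial_y q,-\partial_x q).$$ For every continuous vector field $u\in C(\hat K)^2$ there is exactly one $\hat I_{BDM}u\in BDM_k$ such that $$\int_{F}(\hat I_{BDM}u-u)\cdot n\,q\,ds=0\quad\text{for each edge }F\text{ of }\hat K\text{ and every polynomial }q\text{ of degree at most }k\text{ on }F,$$ $$\int_{\hat K}(\hat I_{BDM}u-u)\cdot q\,dx\,dy=0\quad\text{for all }q\in(P_{k-2})^2,$$ where $n$ is the outer unit normal on $F$. Theorem (Brezzi–Douglas–Marini). Let $1\le\ell\le k$ and $p\in[1,\infty)$. There is a constant $C>0$, depending only on $k$, $\ell$ and $p$, such that for every $u\in C(\hat K)^2$ whose weak divergence satisfies $\operatorname{div}u\in W^{\ell,p}(\hat K)$, $$\|\operatorname{div}(u-\hat I_{BDM}u)\|_{L^p(\hat K)}\le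 C\sum_{\alpha_1+\alpha_2=\ell}\|\partial_x^{\alpha_1}\partial_y^{\alpha_2}\operatorname{div}u\|_{L^p(\hat K)},$$ where the sum runs over all multi-indices $\alpha=(\alpha_1,\alpha_2)\in\mathbb N_0^2$ of order $\ell$ and the derivatives are weak derivatives. -/

import Mathlib

open MeasureTheory
open scoped ENNReal NNReal Distributions

noncomputable section

namespace BDM

open Set

/-! ### The reference square, weak derivatives and Sobolev spaces -/

/-- The reference square `[0,1]²`. -/
def refSquare : Set (ℝ × ℝ) := Icc 0 1 ×ˢ Icc 0 1

/-- The open reference square `(0,1)²`, as an open set. -/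
def openSquare : TopologicalSpace.Opens (ℝ × ℝ) :=
  ⟨Ioo 0 1 ×ˢ Ioo 0 1, isOpen_Ioo.prod isOpen_Ioo⟩

/-- The Lebesgue measure on the reference square. -/
def squareMeasure : Measure (ℝ × ℝ) := volume.restrict refSquare

/-- The classical partial derivative in the first variable. -/
def partialX (f : ℝ × ℝ → ℝ) : ℝ × ℝ → ℝ := fun z => fderiv ℝ f z (1, 0)

/-- The classical partial derivative in the second variable. -/
def partialY (f : ℝ × ℝ → ℝ) : ℝ × ℝ → ℝ := fun z => fderiv ℝ f z (0, 1)

/-- `g` is the weak derivative `∂_x^{α.1} ∂_y^{α.2} f` on the open unit square. -/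
def HasWeakPartial (α : ℕ × ℕ) (f g : ℝ × ℝ → ℝ) : Prop :=
  LocallyIntegrableOn f openSquare ∧ LocallyIntegrableOn g openSquare ∧
    ∀ φ : 𝓓(openSquare, ℝ),
      ∫ z, f z * (partialX^[α.1] (partialY^[α.2] φ)) z ∂squareMeasure =
        (-1) ^ (α.1 + α.2) * ∫ z, g z * φ z ∂squareMeasure

/-- `w` is the weak divergence of the vector field `u` on the open unit square. -/
def HasWeakDiv (u : ℝ × ℝ → ℝ × ℝ) (w : ℝ × ℝ → ℝ) : Prop :=
  LocallyIntegrableOn u openSquare ∧ LocallyIntegrableOn w openSquare ∧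
    ∀ φ : 𝓓(openSquare, ℝ),
      ∫ z, ((u z).1 * partialX φ z + (u z).2 * partialY φ z) ∂squareMeasure =
        -∫ z, w z * φ z ∂squareMeasure

/-- Membership in the Sobolev space `W^{ℓ,p}` of the unit square: `f` and all its weak derivatives
of order at most `ℓ` exist and lie in `L^p`. -/
def MemSobolev (ℓ : ℕ) (p : ℝ≥0∞) (f : ℝ × ℝ → ℝ) : Prop :=
  MemLp f p squareMeasure ∧
    ∀ α : ℕ × ℕ, α.1 + α.2 ≤ ℓ → ∃ g, HasWeakPartial α f g ∧ MemLp g p squareMeasure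

/-! ### The Brezzi-Douglas-Marini space -/

/-- Real polynomials in two variables; `X 0` is `x` and `X 1` is `y`. -/
abbrev Poly : Type := MvPolynomial (Fin 2) ℝ

/-- The value of a polynomial at a point of the plane. -/
def evalAt (z : ℝ × ℝ) (q : Poly) : ℝ := MvPolynomial.eval ![z.1, z.2] q

/-- The vector field given by a pair of polynomials. -/
def toField (v : Poly × Poly) : ℝ × ℝ → ℝ × ℝ := fun z => (evalAt z v.1, evalAt z v.2)

/-- The vector curl `(∂_y q, -∂_x q)` of a scalar polynomial. -/
def curl (q : Poly) : Poly × Poly := (MvPolynomial.pderiv 1 q, -MvPolynomial.pderiv 0 q)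

/-- The divergence of a polynomial vector field. -/
def divPoly (v : Poly × Poly) : Poly := MvPolynomial.pderiv 0 v.1 + MvPolynomial.pderiv 1 v.2

/-- The space `BDM_k = (P_k)² ⊕ span {curl (x^{k+1} y), curl (x y^{k+1})}`, where `P_k` is the
space of polynomials of total degree at most `k`. -/
def bdmSpace (k : ℕ) : Submodule ℝ (Poly × Poly) :=
  (MvPolynomial.restrictTotalDegree (Fin 2) ℝ k).prod
      (MvPolynomial.restrictTotalDegree (Fin 2) ℝ k) ⊔
    Submodule.span ℝ
      {curl (MvPolynomial.X 0 ^ (k + 1) * MvPolynomial.X 1),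
        curl (MvPolynomial.X 0 * MvPolynomial.X 1 ^ (k + 1))}

/-! ### The interpolation operator -/

/-- The four edges of the unit square. -/
inductive Edge : Type
  | left
  | right
  | bottom
  | top

/-- The arc length parametrization, over `[0,1]`, of an edge. -/
def Edge.point : Edge → ℝ → ℝ × ℝ
  | .left, t => (0, t)
  | .right, t => (1, t)
  | .bottom, t => (t, 0)
  | .top, t => (t, 1)

/-- The outer unit normal on an edge. -/
def Edge.normal : Edge → ℝ × ℝ
  | .left => (-1, 0)
  | .right => (1, 0)
  | .bottom => (0, -1)
  | .top => (0, 1)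

/-- The Euclidean scalar product of the plane. -/
def dot (a b : ℝ × ℝ) : ℝ := a.1 * b.1 + a.2 * b.2

/-- `v` is the `BDM_k` interpolant of the (continuous) vector field `u`: it lies in `BDM_k`, the
normal component of `v - u` on each edge is orthogonal to all polynomials of degree at most `k` on
that edge, and `v - u` is orthogonal to `(P_{k-2})²` on the square. The condition
`totalDegree + 2 ≤ k` makes the last family of test functions empty for `k ≤ 1`. -/
def IsBDMInterpolant (k : ℕ) (u : ℝ × ℝ → ℝ × ℝ) (v : Poly × Poly) : Prop :=
  v ∈ bdmSpace k ∧
    (∀ (F : Edge) (q : Polynomial ℝ), q.natDegree ≤ k →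
      ∫ t in (0 : ℝ)..1, dot (toField v (F.point t) - u (F.point t)) F.normal * q.eval t = 0) ∧
    (∀ q : Poly × Poly, q.1.totalDegree + 2 ≤ k → q.2.totalDegree + 2 ≤ k →
      ∫ z, dot (toField v z - u z) (toField q z) ∂squareMeasure = 0)

end BDM

end

/-!
# The divergence estimate for Brezzi-Douglas-Marini interpolation on the unit square

Existence and uniqueness of the interpolant follow from unisolvence together with a dimension count
(`eq_zero_of_moments_eq_zero`, `degreesOfFreedom_surjective`). The normal trace of an element of
`BDM_k` on an edge is a polynomial of degree at most `k`, so vanishing edge moments make it zero.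
Each component then vanishes on two opposite sides, hence is a multiple of `x (x - 1)` or
`y (y - 1)`; comparing one coefficient removes the two curls, and the interior moments remove the
remaining factor.

For the estimate, Green's formula (`green_formula`) holds up to the boundary for a continuous field
whose weak divergence is integrable. Tested with polynomials `q` of degree less than `k`, it shows
that `div (u - I u)` is orthogonal to them (`IsBDMInterpolant.integral_div_mul_eq_zero`), since
`∇ q` and the traces of `q` are admissible in the interpolation conditions. As `div (I u)` itself
has degree less than `k`, it is the `L²` projection of `div u`. This projection is quasi-optimal in
`L^p` (`exists_eLpNorm_sub_le_of_orthogonal`), so it suffices to approximate `div u` by one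
polynomial of degree less than `ℓ`, which is the Bramble-Hilbert lemma
(`exists_eLpNorm_sub_evalAt_le`).

The Bramble-Hilbert lemma is obtained by iterating the Poincaré inequality
(`eLpNorm_sub_integral_le`). All weak derivatives are tested only on products `ψ(x) η(y)` of test
functions of one variable. This reduces both the Poincaré inequality and Green's formula to the fact
that a function on `[0,1]` with integrable weak derivative is a primitive of it
(`ae_eq_primitive_of_weak_deriv`), applied in one variable at a time.
-/

namespace BDM

open Set

/-! ### Weak derivatives on the unit interval -/

/-- The Lebesgue measure on the unit interval. -/
noncomputable def unitMeasure : Measure ℝ := volume.restrict (Icc 0 1)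

instance : IsProbabilityMeasure unitMeasure := ⟨by simp [unitMeasure]⟩

lemma squareMeasure_eq_prod : squareMeasure = unitMeasure.prod unitMeasure := by
  rw [squareMeasure, refSquare, unitMeasure, Measure.prod_restrict, Measure.volume_eq_prod]

instance : IsProbabilityMeasure squareMeasure := by
  rw [squareMeasure_eq_prod]; infer_instance

lemma integral_unitMeasure (f : ℝ → ℝ) : ∫ x, f x ∂unitMeasure = ∫ x in (0 : ℝ)..1, f x := by
  rw [unitMeasure, intervalIntegral.integral_of_le zero_le_one, integral_Icc_eq_integral_Ioc]

lemma intervalIntegrable_of_integrable_unit {V : ℝ → ℝ} (hV : Integrable V unitMeasure)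
    {a b : ℝ} (ha : a ∈ Icc (0 : ℝ) 1) (hb : b ∈ Icc (0 : ℝ) 1) :
    IntervalIntegrable V volume a b := by
  rw [intervalIntegrable_iff]
  refine IntegrableOn.mono_set (t := Icc 0 1) hV (uIoc_subset_uIcc.trans ?_)
  exact (convex_Icc (0 : ℝ) 1).ordConnected.uIcc_subset ha hb

lemma integrable_unitMeasure_of_continuousOn {f : ℝ → ℝ} (hf : ContinuousOn f (Icc 0 1)) :
    Integrable f unitMeasure :=
  hf.integrableOn_Icc

/-- Smooth functions with compact support in the open unit interval. -/
def IsTest (ψ : ℝ → ℝ) : Prop :=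
  ContDiff ℝ (⊤ : ℕ∞) ψ ∧ HasCompactSupport ψ ∧ tsupport ψ ⊆ Ioo 0 1

namespace IsTest

variable {ψ θ : ℝ → ℝ}

lemma continuous (h : IsTest ψ) : Continuous ψ := h.1.continuous

lemma deriv (h : IsTest ψ) : IsTest (deriv ψ) :=
  ⟨(contDiff_infty_iff_deriv.mp h.1).2, h.2.1.deriv,
    (closure_minimal (support_deriv_subset (f := ψ)) (isClosed_tsupport ψ)).trans h.2.2⟩

lemma iterate_deriv (h : IsTest ψ) : ∀ n : ℕ, IsTest (_root_.deriv^[n] ψ)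
  | 0 => h
  | n + 1 => by
    rw [Function.iterate_succ_apply']
    exact (h.iterate_deriv n).deriv

lemma const_mul (h : IsTest ψ) (c : ℝ) : IsTest (fun x => c * ψ x) :=
  ⟨contDiff_const.mul h.1, h.2.1.mul_left (f := fun _ => c),
    (tsupport_mul_subset_right (f := fun _ => c) (g := ψ)).trans h.2.2⟩

lemma sub (h : IsTest ψ) (h' : IsTest θ) : IsTest (fun x => ψ x - θ x) :=
  ⟨h.1.sub h'.1, h.2.1.sub h'.2.1, (tsupport_sub ψ θ).trans (union_subset h.2.2 h'.2.2)⟩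

lemma eq_zero_of_notMem (h : IsTest ψ) {x : ℝ} (hx : x ∉ Ioo (0 : ℝ) 1) : ψ x = 0 :=
  image_eq_zero_of_notMem_tsupport fun h' => hx (h.2.2 h')

lemma integrable (h : IsTest ψ) : Integrable ψ unitMeasure :=
  integrable_unitMeasure_of_continuousOn h.continuous.continuousOn

lemma integral_eq (h : IsTest ψ) : ∫ x, ψ x ∂unitMeasure = ∫ x, ψ x := by
  rw [unitMeasure]
  refine setIntegral_eq_integral_of_forall_compl_eq_zero fun x hx => ?_
  exact h.eq_zero_of_notMem fun h' => hx (Ioo_subset_Icc_self h')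

lemma bounded (h : IsTest ψ) : ∃ C, ∀ x, ‖ψ x‖ ≤ C :=
  h.continuous.bounded_above_of_compact_support h.2.1

lemma exists_integral_eq_one : ∃ χ, IsTest χ ∧ ∫ x, χ x ∂unitMeasure = 1 := by
  let f : ContDiffBump (1 / 2 : ℝ) := ⟨1 / 8, 1 / 4, by norm_num, by norm_num⟩
  have hT : IsTest (f.normed volume) := by
    refine ⟨f.contDiff_normed, f.hasCompactSupport_normed, ?_⟩
    rw [f.tsupport_normed_eq, Real.closedBall_eq_Icc]
    intro x hx
    simp only [f, mem_Icc, mem_Ioo] at hx ⊢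
    constructor <;> linarith [hx.1, hx.2]
  exact ⟨_, hT, by rw [hT.integral_eq, f.integral_normed]⟩

/-- A test function of mean zero is the derivative of a test function: its primitive from `0`
vanishes near `1` as well. -/
lemma exists_deriv_eq (h : IsTest ψ) (h0 : ∫ x, ψ x ∂unitMeasure = 0) :
    ∃ Ψ, IsTest Ψ ∧ _root_.deriv Ψ = ψ := by
  have hd : ∀ x, HasDerivAt (fun x => ∫ s in (0 : ℝ)..x, ψ s) (ψ x) x := fun x =>
    intervalIntegral.integral_hasDerivAt_right (h.continuous.intervalIntegrable _ _)
      (h.continuous.stronglyMeasurableAtFilter _ _) h.continuous.continuousAt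
  have hderiv : _root_.deriv (fun x => ∫ s in (0 : ℝ)..x, ψ s) = ψ :=
    funext fun x => (hd x).deriv
  rw [integral_unitMeasure] at h0
  obtain ⟨a, b, ha, hb, hab⟩ : ∃ a b : ℝ, 0 < a ∧ b < 1 ∧ tsupport ψ ⊆ Icc a b := by
    rcases (tsupport ψ).eq_empty_or_nonempty with he | hne
    · exact ⟨1 / 2, 1 / 2, by norm_num, by norm_num, by simp [he]⟩
    · obtain ⟨a, ha⟩ := h.2.1.isCompact.exists_isLeast hne
      obtain ⟨b, hb⟩ := h.2.1.isCompact.exists_isGreatest hne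
      exact ⟨a, b, (h.2.2 ha.1).1, (h.2.2 hb.1).2, fun x hx => ⟨ha.2 hx, hb.2 hx⟩⟩
  have hz : ∀ x, x ∉ Icc a b → ψ x = 0 := fun x hx =>
    image_eq_zero_of_notMem_tsupport fun h' => hx (hab h')
  have hsupp : tsupport (fun x => ∫ s in (0 : ℝ)..x, ψ s) ⊆ Icc a b := by
    refine closure_minimal (fun x hx => ?_) isClosed_Icc
    by_contra hxab
    refine hx ?_
    rw [mem_Icc, not_and_or, not_le, not_le] at hxab
    rcases hxab with hxa | hxb
    · refine (intervalIntegral.integral_congr (g := fun _ => (0 : ℝ)) fun s hs => ?_).trans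
        (by simp)
      refine hz s fun hs' => ?_
      rcases le_total 0 x with h0x | h0x
      · rw [uIcc_of_le h0x] at hs; linarith [hs.2, hs'.1]
      · rw [uIcc_of_ge h0x] at hs; linarith [hs.2, hs'.1]
    · have h1 : ∫ s in (1 : ℝ)..x, ψ s = 0 := by
        refine (intervalIntegral.integral_congr (g := fun _ => (0 : ℝ)) fun s hs => ?_).trans
          (by simp)
        refine hz s fun hs' => ?_
        rcases le_total 1 x with h0x | h0x
        · rw [uIcc_of_le h0x] at hs; linarith [hs.1, hs'.2]
        · rw [uIcc_of_ge h0x] at hs; linarith [hs.1, hs'.2]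
      have h2 := intervalIntegral.integral_add_adjacent_intervals
        (h.continuous.intervalIntegrable (μ := volume) 0 1)
        (h.continuous.intervalIntegrable (μ := volume) 1 x)
      simp only
      rw [← h2, h0, h1, add_zero]
  refine ⟨_, ⟨?_, ?_, hsupp.trans fun x hx => ⟨ha.trans_le hx.1, hx.2.trans_lt hb⟩⟩, hderiv⟩
  · rw [contDiff_infty_iff_deriv]
    exact ⟨fun x => (hd x).differentiableAt, by rw [hderiv]; exact h.1⟩
  · exact HasCompactSupport.of_support_subset_isCompact isCompact_Icc
      (subset_closure.trans hsupp)

end IsTest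

/-- The fundamental lemma of the calculus of variations on the unit interval. -/
lemma ae_eq_zero_of_forall_isTest {V : ℝ → ℝ} (hV : Integrable V unitMeasure)
    (h : ∀ ψ, IsTest ψ → ∫ x, V x * ψ x ∂unitMeasure = 0) : ∀ᵐ x ∂unitMeasure, V x = 0 := by
  have hV' : IntegrableOn V (Ioo 0 1) := IntegrableOn.mono_set (t := Icc 0 1) hV Ioo_subset_Icc_self
  have key := isOpen_Ioo.ae_eq_zero_of_integral_contDiff_smul_eq_zero (μ := volume) (f := V)
    (U := Ioo (0 : ℝ) 1) hV'.locallyIntegrableOn fun g hg hgc hgs => by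
      have hT : IsTest g := ⟨hg, hgc, hgs⟩
      rw [← h g hT, unitMeasure]
      symm
      simp_rw [smul_eq_mul, mul_comm (V _)]
      refine setIntegral_eq_integral_of_forall_compl_eq_zero fun x hx => ?_
      rw [hT.eq_zero_of_notMem fun h' => hx (Ioo_subset_Icc_self h'), zero_mul]
  rw [unitMeasure, ← restrict_Ioo_eq_restrict_Icc]
  rwa [ae_restrict_iff' measurableSet_Ioo]

lemma integrable_mul_isTest {V ψ : ℝ → ℝ} (hV : Integrable V unitMeasure) (hψ : IsTest ψ) :
    Integrable (fun x => V x * ψ x) unitMeasure := by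
  obtain ⟨C, hC⟩ := hψ.bounded
  exact hV.mul_bdd (c := C) hψ.continuous.aestronglyMeasurable (.of_forall hC)

/-- A function on the unit interval with weak derivative zero is constant. -/
lemma ae_eq_const_of_weak_deriv_eq_zero {U : ℝ → ℝ} (hU : Integrable U unitMeasure)
    (h : ∀ ψ, IsTest ψ → ∫ x, U x * deriv ψ x ∂unitMeasure = 0) :
    ∃ c, ∀ᵐ x ∂unitMeasure, U x = c := by
  obtain ⟨χ, hχ, hχ1⟩ := IsTest.exists_integral_eq_one
  refine ⟨∫ x, U x * χ x ∂unitMeasure, ?_⟩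
  suffices h' : ∀ᵐ x ∂unitMeasure, U x - ∫ x, U x * χ x ∂unitMeasure = 0 by
    filter_upwards [h'] with x hx
    linarith
  refine ae_eq_zero_of_forall_isTest (hU.sub (integrable_const _)) fun θ hθ => ?_
  -- `θ - (∫ θ) χ` has mean zero, hence is the derivative of a test function
  set m := ∫ x, θ x ∂unitMeasure with hm
  obtain ⟨Θ, hΘ, hd⟩ := (hθ.sub (hχ.const_mul m)).exists_deriv_eq (by
    rw [integral_sub hθ.integrable (hχ.const_mul m).integrable, integral_const_mul, hχ1]
    simp [hm])
  have := h Θ hΘ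
  rw [hd] at this
  simp_rw [mul_sub, mul_left_comm _ m] at this
  rw [integral_sub (integrable_mul_isTest hU hθ) ((integrable_mul_isTest hU hχ).const_mul m),
    integral_const_mul] at this
  simp_rw [sub_mul]
  rw [integral_sub (integrable_mul_isTest hU hθ) (hθ.integrable.const_mul _), integral_const_mul]
  linarith

/-- Integration by parts on the unit interval for a primitive of an integrable function. -/
lemma integral_primitive_mul_deriv {V ψ : ℝ → ℝ} (hV : Integrable V unitMeasure)
    (hψ : ContDiff ℝ 1 ψ) :
    ∫ x, (∫ s in (0 : ℝ)..x, V s) * deriv ψ x ∂unitMeasure =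
      (∫ s in (0 : ℝ)..1, V s) * ψ 1 - ∫ x, V x * ψ x ∂unitMeasure := by
  have h0 : (0 : ℝ) ∈ Icc (0 : ℝ) 1 := by simp
  have h1 : (1 : ℝ) ∈ Icc (0 : ℝ) 1 := by simp
  have hVi : IntervalIntegrable V volume 0 1 := intervalIntegrable_of_integrable_unit hV h0 h1
  have hW := hVi.absolutelyContinuousOnInterval_intervalIntegral (c := 0) (by simp)
  have hψa : AbsolutelyContinuousOnInterval ψ 0 1 :=
    hψ.contDiffOn.absolutelyContinuousOnInterval
  rw [integral_unitMeasure, hW.integral_mul_deriv_eq_deriv_mul hψa, integral_unitMeasure]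
  simp only [intervalIntegral.integral_same, zero_mul, sub_zero]
  congr 1
  refine intervalIntegral.integral_congr_ae ?_
  have := hVi.ae_hasDerivAt_integral
  filter_upwards [this] with x hx hx'
  rw [(hx (uIoc_subset_uIcc hx') 0 (by simp)).deriv]

lemma continuousOn_primitive_unit {V : ℝ → ℝ} (hV : Integrable V unitMeasure) :
    ContinuousOn (fun x => ∫ s in (0 : ℝ)..x, V s) (Icc 0 1) := by
  have := intervalIntegral.continuousOn_primitive_interval (μ := volume) (f := V) (a := 0)
    (b := 1) (by rw [uIcc_of_le zero_le_one]; exact hV)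
  rwa [uIcc_of_le zero_le_one] at this

/-- A function with an integrable weak derivative is almost everywhere a primitive of it. -/
lemma ae_eq_primitive_of_weak_deriv {U V : ℝ → ℝ} (hU : Integrable U unitMeasure)
    (hV : Integrable V unitMeasure)
    (h : ∀ ψ, IsTest ψ → ∫ x, (U x * deriv ψ x + V x * ψ x) ∂unitMeasure = 0) :
    ∃ c, ∀ᵐ x ∂unitMeasure, U x = c + ∫ s in (0 : ℝ)..x, V s := by
  have hWc := continuousOn_primitive_unit hV
  have hW : Integrable (fun x => ∫ s in (0 : ℝ)..x, V s) unitMeasure :=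
    integrable_unitMeasure_of_continuousOn hWc
  obtain ⟨c, hc⟩ := ae_eq_const_of_weak_deriv_eq_zero (hU.sub hW) fun ψ hψ => by
    have h1 := h ψ hψ
    rw [integral_add (integrable_mul_isTest hU hψ.deriv) (integrable_mul_isTest hV hψ)] at h1
    have h2 := integral_primitive_mul_deriv hV (hψ.1.of_le (by exact_mod_cast le_top))
    rw [hψ.eq_zero_of_notMem (x := 1) (by simp)] at h2
    simp_rw [Pi.sub_apply, sub_mul]
    rw [integral_sub (integrable_mul_isTest hU hψ.deriv) (integrable_mul_isTest hW hψ.deriv)]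
    linarith
  refine ⟨c, ?_⟩
  filter_upwards [hc] with x hx
  rw [← hx]
  simp

/-- A continuous function on `[0,1]` with an integrable weak derivative can be integrated by parts
against functions that do not vanish at the end points. -/
lemma integral_by_parts_of_weak_deriv {U V ψ : ℝ → ℝ} (hU : ContinuousOn U (Icc 0 1))
    (hV : Integrable V unitMeasure)
    (h : ∀ ψ, IsTest ψ → ∫ x, (U x * deriv ψ x + V x * ψ x) ∂unitMeasure = 0)
    (hψ : ContDiff ℝ 1 ψ) :
    ∫ x, (U x * deriv ψ x + V x * ψ x) ∂unitMeasure = U 1 * ψ 1 - U 0 * ψ 0 := by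
  obtain ⟨c, hc⟩ := ae_eq_primitive_of_weak_deriv (integrable_unitMeasure_of_continuousOn hU) hV h
  have hWc := continuousOn_primitive_unit hV
  have heq : EqOn U (fun x => c + ∫ s in (0 : ℝ)..x, V s) (Icc 0 1) :=
    Measure.eqOn_Icc_of_ae_eq volume zero_ne_one hc hU (continuousOn_const.add hWc)
  have hd : Continuous (deriv ψ) := hψ.continuous_deriv le_rfl
  have hdi : Integrable (deriv ψ) unitMeasure :=
    integrable_unitMeasure_of_continuousOn hd.continuousOn
  have hVψ : Integrable (fun x => V x * ψ x) unitMeasure := by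
    obtain ⟨C, hC⟩ := isCompact_Icc.exists_bound_of_continuousOn
      (hψ.continuous.continuousOn (s := Icc (0 : ℝ) 1))
    refine hV.mul_bdd (c := C) hψ.continuous.aestronglyMeasurable ?_
    exact (ae_restrict_iff' measurableSet_Icc).2 (.of_forall hC)
  have hWψ : Integrable (fun x => (∫ s in (0 : ℝ)..x, V s) * deriv ψ x) unitMeasure :=
    integrable_unitMeasure_of_continuousOn (hWc.mul hd.continuousOn)
  have h1 : ∫ x, U x * deriv ψ x ∂unitMeasure =
      ∫ x, (c * deriv ψ x + (∫ s in (0 : ℝ)..x, V s) * deriv ψ x) ∂unitMeasure := by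
    refine integral_congr_ae ?_
    filter_upwards [hc] with x hx
    rw [hx, add_mul]
  have hUψ : Integrable (fun x => U x * deriv ψ x) unitMeasure :=
    integrable_unitMeasure_of_continuousOn (hU.mul hd.continuousOn)
  rw [integral_add hUψ hVψ, h1,
    integral_add (hdi.const_mul c) hWψ, integral_primitive_mul_deriv hV hψ, integral_const_mul,
    integral_unitMeasure (deriv ψ), intervalIntegral.integral_deriv_eq_sub' ψ rfl
        (fun x _ => (hψ.differentiable one_ne_zero).differentiableAt) hd.continuousOn,
    heq (by simp), heq (by simp)]
  simp only [intervalIntegral.integral_same]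
  ring

/-! ### The Poincaré inequality on the unit square -/

/-- `h` is the weak derivative of `f` in the first variable, tested on the products
`ψ(x) η(y)` only. -/
def WeakX (f h : ℝ × ℝ → ℝ) : Prop :=
  ∀ ψ η, IsTest ψ → IsTest η →
    ∫ z, (f z * deriv ψ z.1 + h z * ψ z.1) * η z.2 ∂squareMeasure = 0

/-- `h` is the weak derivative of `f` in the second variable, tested on the products
`ψ(x) η(y)` only. -/
def WeakY (f h : ℝ × ℝ → ℝ) : Prop :=
  ∀ ψ η, IsTest ψ → IsTest η →
    ∫ z, (f z * deriv η z.2 + h z * η z.2) * ψ z.1 ∂squareMeasure = 0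

lemma measurePreserving_swap_square :
    MeasurePreserving Prod.swap squareMeasure squareMeasure := by
  rw [squareMeasure_eq_prod]; exact Measure.measurePreserving_swap

lemma integral_comp_swap_square (f : ℝ × ℝ → ℝ) :
    ∫ z, f z.swap ∂squareMeasure = ∫ z, f z ∂squareMeasure := by
  rw [squareMeasure_eq_prod]
  exact integral_prod_swap (μ := unitMeasure) (ν := unitMeasure) f

lemma WeakY.comp_swap {f h : ℝ × ℝ → ℝ} (H : WeakY f h) :
    WeakX (f ∘ Prod.swap) (h ∘ Prod.swap) := by
  intro ψ η hψ hη
  rw [← H η ψ hη hψ, ← integral_comp_swap_square]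
  rfl

lemma integrable_mul_comp_isTest {f : ℝ × ℝ → ℝ} (hf : Integrable f squareMeasure) {ψ : ℝ → ℝ}
    (hψ : IsTest ψ) : Integrable (fun z => f z * ψ z.1) squareMeasure := by
  obtain ⟨C, hC⟩ := hψ.bounded
  exact hf.mul_bdd (c := C) (hψ.continuous.comp continuous_fst).aestronglyMeasurable
    (.of_forall fun z => hC z.1)

/-- Testing in the second variable may be replaced by integrating over a measurable set. -/
lemma WeakX.setIntegral_snd {f h : ℝ × ℝ → ℝ} (hf : Integrable f squareMeasure)
    (hh : Integrable h squareMeasure) (H : WeakX f h) {B : Set ℝ} {ψ : ℝ → ℝ} (hψ : IsTest ψ) :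
    ∫ x, ((∫ y in B, f (x, y) ∂unitMeasure) * deriv ψ x +
      (∫ y in B, h (x, y) ∂unitMeasure) * ψ x) ∂unitMeasure = 0 := by
  set F : ℝ × ℝ → ℝ := fun z => f z * deriv ψ z.1 + h z * ψ z.1 with hF
  have hFi : Integrable F squareMeasure :=
    (integrable_mul_comp_isTest hf hψ.deriv).add (integrable_mul_comp_isTest hh hψ)
  rw [squareMeasure_eq_prod] at hFi hf hh
  have h0 : ∀ᵐ y ∂unitMeasure, ∫ x, F (x, y) ∂unitMeasure = 0 := by
    refine ae_eq_zero_of_forall_isTest hFi.integral_prod_right fun η hη => ?_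
    rw [← H ψ η hψ hη, squareMeasure_eq_prod]
    obtain ⟨C, hC⟩ := hη.bounded
    rw [integral_prod_symm]
    · refine integral_congr_ae (.of_forall fun y => ?_)
      simp only
      rw [← integral_mul_const]
    · exact hFi.mul_bdd (c := C) (hη.continuous.comp continuous_snd).aestronglyMeasurable
        (.of_forall fun z => hC z.2)
  have hFB : Integrable F (unitMeasure.prod (unitMeasure.restrict B)) :=
    hFi.mono_measure (Measure.prod_mono le_rfl Measure.restrict_le_self)
  have hfB := hf.mono_measure
    (Measure.prod_mono (le_refl unitMeasure) (Measure.restrict_le_self (s := B)))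
  have hhB := hh.mono_measure
    (Measure.prod_mono (le_refl unitMeasure) (Measure.restrict_le_self (s := B)))
  calc _ = ∫ x, ∫ y in B, F (x, y) ∂unitMeasure ∂unitMeasure := by
        refine integral_congr_ae ?_
        filter_upwards [hfB.prod_right_ae, hhB.prod_right_ae] with x h1 h2
        simp only [hF]
        rw [integral_add (h1.mul_const _) (h2.mul_const _), integral_mul_const, integral_mul_const]
    _ = ∫ y in B, ∫ x, F (x, y) ∂unitMeasure ∂unitMeasure :=
        integral_integral_swap (f := fun x y => F (x, y)) hFB
    _ = 0 := by
        rw [integral_eq_zero_of_ae (ae_restrict_of_ae h0)]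

/-- An integrable function whose integrals over all rectangles vanish is zero. -/
lemma ae_eq_zero_of_forall_rectangle {G : ℝ × ℝ → ℝ} (hG : Integrable G squareMeasure)
    (h : ∀ A B, MeasurableSet A → MeasurableSet B → ∫ z in A ×ˢ B, G z ∂squareMeasure = 0) :
    ∀ᵐ z ∂squareMeasure, G z = 0 := by
  refine hG.ae_eq_zero_of_forall_setIntegral_eq_zero fun s hs _ => ?_
  induction s, hs using MeasurableSpace.induction_on_inter
    (h_eq := generateFrom_prod.symm) (h_inter := isPiSystem_prod) with
  | empty => simp
  | basic t ht =>
    obtain ⟨A, hA, B, hB, rfl⟩ := ht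
    exact h A B hA hB
  | compl t ht ih =>
    have h1 := integral_add_compl ht hG
    have h2 := h univ univ .univ .univ
    rw [univ_prod_univ, Measure.restrict_univ] at h2
    have h3 := ih (measure_lt_top _ _)
    linarith
  | iUnion s hd hs ih =>
    rw [integral_iUnion hs hd hG.integrableOn]
    simp [fun i => ih i (measure_lt_top _ _)]

/-- A function is independent of the first variable as soon as all its averages over measurable
sets in the second variable are. -/
lemma ae_eq_integral_fst {F : ℝ × ℝ → ℝ} (hF : Integrable F squareMeasure)
    (h : ∀ B, MeasurableSet B →
      ∃ c, ∀ᵐ x ∂unitMeasure, ∫ y in B, F (x, y) ∂unitMeasure = c) :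
    ∀ᵐ z ∂squareMeasure, F z = ∫ s, F (s, z.2) ∂unitMeasure := by
  have hF' := hF
  rw [squareMeasure_eq_prod] at hF'
  have hc : Integrable (fun y => ∫ s, F (s, y) ∂unitMeasure) unitMeasure :=
    hF'.integral_prod_right
  have hc2 : Integrable (fun z : ℝ × ℝ => ∫ s, F (s, z.2) ∂unitMeasure) squareMeasure := by
    rw [squareMeasure_eq_prod]; exact hc.comp_snd unitMeasure
  suffices h' : ∀ᵐ z ∂squareMeasure, F z - ∫ s, F (s, z.2) ∂unitMeasure = 0 by
    filter_upwards [h'] with z hz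
    linarith
  refine ae_eq_zero_of_forall_rectangle (hF.sub hc2) fun A B hA hB => ?_
  obtain ⟨c, hcB⟩ := h B hB
  have e1 : ∫ z in A ×ˢ B, F z ∂squareMeasure = unitMeasure.real A * c := by
    have : IntegrableOn F (A ×ˢ B) (unitMeasure.prod unitMeasure) := hF'.integrableOn
    rw [squareMeasure_eq_prod, setIntegral_prod F this]
    rw [integral_congr_ae (ae_restrict_of_ae hcB)]
    simp
  have e2 : ∫ z in A ×ˢ B, (∫ s, F (s, z.2) ∂unitMeasure) ∂squareMeasure =
      unitMeasure.real A * c := by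
    have hFB : Integrable F (unitMeasure.prod (unitMeasure.restrict B)) :=
      hF'.mono_measure (Measure.prod_mono le_rfl Measure.restrict_le_self)
    rw [squareMeasure_eq_prod] at hc2 ⊢
    rw [setIntegral_prod _ hc2.integrableOn]
    simp only [integral_const, smul_eq_mul, measureReal_restrict_apply_univ]
    rw [← integral_integral_swap (f := fun x y => F (x, y)) hFB, integral_congr_ae hcB]
    simp
  rw [integral_sub hF.integrableOn hc2.integrableOn, e1, e2, sub_self]

/-- The primitive in the first variable, `∫₀ˣ h(s, y) ds`. -/
noncomputable def primX (h : ℝ × ℝ → ℝ) (z : ℝ × ℝ) : ℝ :=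
  ∫ s, (Iic z.1).indicator (fun s => h (s, z.2)) s ∂unitMeasure

lemma integral_indicator_Iic {x : ℝ} (hx : x ∈ Icc (0 : ℝ) 1) (V : ℝ → ℝ) :
    ∫ s, (Iic x).indicator V s ∂unitMeasure = ∫ s in (0 : ℝ)..x, V s := by
  rw [integral_indicator measurableSet_Iic, unitMeasure, Measure.restrict_restrict measurableSet_Iic,
    intervalIntegral.integral_of_le hx.1, ← integral_Icc_eq_integral_Ioc]
  congr 2
  ext s
  simp only [mem_inter_iff, mem_Iic, mem_Icc]
  exact ⟨fun h => ⟨h.2.1, h.1⟩, fun h => ⟨h.2, h.1, h.2.trans hx.2⟩⟩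

lemma integrable_indicator_primX {h : ℝ × ℝ → ℝ} (hh : Integrable h squareMeasure) :
    Integrable (fun p : (ℝ × ℝ) × ℝ => (Iic p.1.1).indicator (fun s => h (s, p.1.2)) p.2)
      (squareMeasure.prod unitMeasure) := by
  have hm : MeasurePreserving (fun p : (ℝ × ℝ) × ℝ => (p.2, p.1.2))
      (squareMeasure.prod unitMeasure) squareMeasure := by
    rw [squareMeasure_eq_prod]
    exact (Measure.measurePreserving_swap (μ := unitMeasure) (ν := unitMeasure)).comp
      ((measurePreserving_snd (μ := unitMeasure) (ν := unitMeasure)).prod (.id unitMeasure))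
  have h1 : Integrable (fun p : (ℝ × ℝ) × ℝ => h (p.2, p.1.2)) (squareMeasure.prod unitMeasure) :=
    hm.integrable_comp_of_integrable hh
  have hS : MeasurableSet {p : (ℝ × ℝ) × ℝ | p.2 ≤ p.1.1} :=
    measurableSet_le measurable_snd measurable_fst.fst
  exact (h1.indicator hS).congr (.of_forall fun p => rfl)

lemma integrable_primX {h : ℝ × ℝ → ℝ} (hh : Integrable h squareMeasure) :
    Integrable (primX h) squareMeasure :=
  (integrable_indicator_primX hh).integral_prod_left

lemma abs_primX_le {h : ℝ × ℝ → ℝ} {z : ℝ × ℝ}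
    (hz : Integrable (fun s => h (s, z.2)) unitMeasure) :
    |primX h z| ≤ ∫ s, |h (s, z.2)| ∂unitMeasure := by
  refine (abs_integral_le_integral_abs).trans (integral_mono_of_nonneg
    (.of_forall fun _ => abs_nonneg _) hz.abs (.of_forall fun s => ?_))
  by_cases hs : s ∈ Iic z.1
  · simp [indicator_of_mem hs]
  · simp [indicator_of_notMem hs]

/-- A function with a weak derivative in the first variable differs from the primitive of that
derivative by a function of the second variable only. -/
lemma WeakX.ae_sub_primX_eq {f h : ℝ × ℝ → ℝ} (hf : Integrable f squareMeasure)
    (hh : Integrable h squareMeasure) (H : WeakX f h) :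
    ∀ᵐ z ∂squareMeasure,
      f z - primX h z = ∫ s, (f (s, z.2) - primX h (s, z.2)) ∂unitMeasure := by
  have hP := integrable_primX hh
  refine ae_eq_integral_fst (F := fun z => f z - primX h z) (hf.sub hP) fun B hB => ?_
  have hf' := hf
  have hh' := hh
  rw [squareMeasure_eq_prod] at hf' hh' hP
  have hfB := hf'.mono_measure
    (Measure.prod_mono (le_refl unitMeasure) (Measure.restrict_le_self (s := B)))
  have hhB := hh'.mono_measure
    (Measure.prod_mono (le_refl unitMeasure) (Measure.restrict_le_self (s := B)))
  have hPB := hP.mono_measure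
    (Measure.prod_mono (le_refl unitMeasure) (Measure.restrict_le_self (s := B)))
  obtain ⟨c, hc⟩ := ae_eq_primitive_of_weak_deriv hfB.integral_prod_left hhB.integral_prod_left
    fun ψ hψ => H.setIntegral_snd hf hh hψ
  refine ⟨c, ?_⟩
  have hmem : ∀ᵐ x ∂unitMeasure, x ∈ Icc (0 : ℝ) 1 := ae_restrict_mem measurableSet_Icc
  filter_upwards [hc, hfB.prod_right_ae, hPB.prod_right_ae, hmem] with x h1 h2 h3 hx
  rw [integral_sub h2 h3, h1]
  have h4 : ∫ y in B, primX h (x, y) ∂unitMeasure =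
      ∫ s in (0 : ℝ)..x, ∫ y in B, h (s, y) ∂unitMeasure := by
    rw [← integral_indicator_Iic hx]
    simp only [primX]
    rw [integral_integral_swap]
    · refine integral_congr_ae (.of_forall fun s => ?_)
      by_cases hs : s ∈ Iic x
      · simp [indicator_of_mem hs]
      · simp [indicator_of_notMem hs]
    · have h5 : Integrable (fun p : ℝ × ℝ => (Iic x ×ˢ univ).indicator h p)
          (unitMeasure.prod (unitMeasure.restrict B)) :=
        hhB.indicator (measurableSet_Iic.prod .univ)
      refine h5.swap.congr (.of_forall fun p => ?_)
      by_cases hs : p.2 ∈ Iic x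
      · simp only [Function.comp, Function.uncurry, indicator_of_mem hs]
        rw [indicator_of_mem (by exact ⟨hs, mem_univ _⟩)]
        rfl
      · simp only [Function.comp, Function.uncurry, indicator_of_notMem hs]
        rw [indicator_of_notMem (fun h => hs h.1)]
  rw [h4]
  ring

/-- The oscillation in the first variable is controlled by the weak derivative in the first
variable. -/
lemma WeakX.ae_abs_sub_integral_le {f h : ℝ × ℝ → ℝ} (hf : Integrable f squareMeasure)
    (hh : Integrable h squareMeasure) (H : WeakX f h) :
    ∀ᵐ z ∂squareMeasure,
      |f z - ∫ s, f (s, z.2) ∂unitMeasure| ≤ 2 * ∫ s, |h (s, z.2)| ∂unitMeasure := by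
  have hP := integrable_primX hh
  have h1 := H.ae_sub_primX_eq hf hh
  rw [squareMeasure_eq_prod] at hf hh hP
  have hq : ∀ {P : ℝ → Prop}, (∀ᵐ y ∂unitMeasure, P y) → ∀ᵐ z ∂squareMeasure, P z.2 := by
    intro P hP
    rw [squareMeasure_eq_prod]
    exact Measure.quasiMeasurePreserving_snd.ae hP
  filter_upwards [h1, hq hf.prod_left_ae, hq hh.prod_left_ae, hq hP.prod_left_ae] with z e hf hh hP
  rw [integral_sub hf hP] at e
  have e1 : f z - ∫ s, f (s, z.2) ∂unitMeasure =
      primX h z - ∫ s, primX h (s, z.2) ∂unitMeasure := by linarith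
  have e2 : |∫ s, primX h (s, z.2) ∂unitMeasure| ≤ ∫ s, |h (s, z.2)| ∂unitMeasure := by
    refine (abs_integral_le_integral_abs).trans ?_
    refine (integral_mono_of_nonneg (.of_forall fun _ => abs_nonneg _)
      (integrable_const (∫ s, |h (s, z.2)| ∂unitMeasure))
      (.of_forall fun s => abs_primX_le (z := (s, z.2)) hh)).trans ?_
    simp
  rw [e1]
  have e3 := abs_primX_le (z := z) hh
  have e4 := abs_sub (primX h z) (∫ s, primX h (s, z.2) ∂unitMeasure)
  linarith

/-- Averaging in the first variable is a contraction of `L^p`. -/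
lemma eLpNorm_integral_fst_le {h : ℝ × ℝ → ℝ} {p : ℝ≥0∞} (hp : 1 ≤ p) (hp' : p ≠ ∞)
    (hh : Integrable h squareMeasure) :
    eLpNorm (fun z => ∫ s, |h (s, z.2)| ∂unitMeasure) p squareMeasure ≤
      eLpNorm h p squareMeasure := by
  have hp0 : p ≠ 0 := (zero_lt_one.trans_le hp).ne'
  have hpr : 0 < p.toReal := ENNReal.toReal_pos hp0 hp'
  rw [eLpNorm_eq_lintegral_rpow_enorm_toReal hp0 hp',
    eLpNorm_eq_lintegral_rpow_enorm_toReal hp0 hp']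
  refine ENNReal.rpow_le_rpow ?_ (by positivity)
  have hm : AEMeasurable (fun z => ‖h z‖ₑ ^ p.toReal) (unitMeasure.prod unitMeasure) := by
    rw [← squareMeasure_eq_prod]
    exact hh.aestronglyMeasurable.enorm.pow_const _
  rw [squareMeasure_eq_prod] at hh ⊢
  rw [lintegral_prod_symm _ hm]
  have hmN : AEMeasurable (fun z : ℝ × ℝ => ‖∫ s, |h (s, z.2)| ∂unitMeasure‖ₑ ^ p.toReal)
      (unitMeasure.prod unitMeasure) :=
    ((hh.abs.integral_prod_right.comp_snd unitMeasure).aestronglyMeasurable.enorm.pow_const _)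
  rw [lintegral_prod_symm _ hmN]
  refine lintegral_mono_ae ?_
  filter_upwards [hh.prod_left_ae] with y hy
  simp only [lintegral_const, measure_univ, mul_one]
  have h1 : eLpNorm (fun s => h (s, y)) 1 unitMeasure ≤ eLpNorm (fun s => h (s, y)) p unitMeasure :=
    eLpNorm_le_eLpNorm_of_exponent_le hp hy.aestronglyMeasurable
  rw [eLpNorm_one_eq_lintegral_enorm, eLpNorm_eq_lintegral_rpow_enorm_toReal hp0 hp',
    one_div] at h1
  have h2 : ‖∫ s, |h (s, y)| ∂unitMeasure‖ₑ ≤ ∫⁻ s, ‖h (s, y)‖ₑ ∂unitMeasure := by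
    refine (enorm_integral_le_lintegral_enorm _).trans (le_of_eq ?_)
    simp [← ofReal_norm]
  rw [ENNReal.le_rpow_inv_iff hpr] at h1
  exact (ENNReal.rpow_le_rpow h2 hpr.le).trans h1

/-- The Poincaré inequality on the unit square. -/
lemma eLpNorm_sub_integral_le {f g h : ℝ × ℝ → ℝ} {p : ℝ≥0∞} (hp : 1 ≤ p) (hp' : p ≠ ∞)
    (hf : MemLp f p squareMeasure) (hg : MemLp g p squareMeasure) (hh : MemLp h p squareMeasure)
    (hX : WeakX f g) (hY : WeakY f h) :
    eLpNorm (fun z => f z - ∫ z, f z ∂squareMeasure) p squareMeasure ≤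
      2 * eLpNorm g p squareMeasure + 2 * eLpNorm h p squareMeasure := by
  have hfi := hf.integrable hp
  have hgi := hg.integrable hp
  have hhi := hh.integrable hp
  have h1 := hX.ae_abs_sub_integral_le hfi hgi
  have h2 : ∀ᵐ z ∂squareMeasure, |f z - ∫ t, f (z.1, t) ∂unitMeasure| ≤
      2 * ∫ t, |h (z.1, t)| ∂unitMeasure := by
    have h3 := hY.comp_swap.ae_abs_sub_integral_le
      (measurePreserving_swap_square.integrable_comp_of_integrable hfi)
      (measurePreserving_swap_square.integrable_comp_of_integrable hhi)
    have h4 := measurePreserving_swap_square.quasiMeasurePreserving.ae h3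
    filter_upwards [h4] with z hz
    simpa using hz
  have h5 : ∀ᵐ y ∂unitMeasure,
      |(∫ s, f (s, y) ∂unitMeasure) - ∫ z, f z ∂squareMeasure| ≤ 2 * ∫ z, |h z| ∂squareMeasure := by
    rw [squareMeasure_eq_prod] at h2 hfi hhi ⊢
    have h6 := Measure.ae_ae_of_ae_prod
      ((Measure.measurePreserving_swap (μ := unitMeasure)
        (ν := unitMeasure)).quasiMeasurePreserving.ae h2)
    filter_upwards [h6, hfi.prod_left_ae] with y hy hfy
    rw [integral_prod f hfi, integral_prod _ hhi.abs, ← integral_const_mul,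
      ← integral_sub hfy hfi.integral_prod_left]
    refine abs_integral_le_integral_abs.trans (integral_mono_of_nonneg
      (.of_forall fun _ => abs_nonneg _) (hhi.abs.integral_prod_left.const_mul 2) ?_)
    filter_upwards [hy] with x hx
    simpa using hx
  have h7 : ∀ᵐ z ∂squareMeasure, |(∫ s, f (s, z.2) ∂unitMeasure) - ∫ z, f z ∂squareMeasure| ≤
      2 * ∫ z, |h z| ∂squareMeasure := by
    rw [squareMeasure_eq_prod] at h5 ⊢
    exact Measure.quasiMeasurePreserving_snd.ae h5
  have hgN : AEStronglyMeasurable (fun z : ℝ × ℝ => ∫ s, |g (s, z.2)| ∂unitMeasure)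
      squareMeasure := by
    rw [squareMeasure_eq_prod] at hgi ⊢
    exact (hgi.abs.integral_prod_right.comp_snd unitMeasure).aestronglyMeasurable
  calc _ ≤ eLpNorm (fun z => 2 * (∫ s, |g (s, z.2)| ∂unitMeasure) +
        2 * ∫ z, |h z| ∂squareMeasure) p squareMeasure := by
        refine eLpNorm_mono_ae_real ?_
        filter_upwards [h1, h7] with z hz1 hz2
        rw [Real.norm_eq_abs]
        exact (abs_sub_le _ _ _).trans (add_le_add hz1 hz2)
    _ ≤ eLpNorm (fun z => 2 * (∫ s, |g (s, z.2)| ∂unitMeasure)) p squareMeasure +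
        eLpNorm (fun _ => 2 * ∫ z, |h z| ∂squareMeasure) p squareMeasure :=
        eLpNorm_add_le (hgN.const_mul 2) aestronglyMeasurable_const hp
    _ ≤ _ := by
        gcongr
        · refine (eLpNorm_const_smul_le (c := (2 : ℝ))
            (f := fun z : ℝ × ℝ => ∫ s, |g (s, z.2)| ∂unitMeasure)).trans ?_
          rw [show ‖(2 : ℝ)‖ₑ = 2 by simp [enorm_eq_nnnorm]]
          gcongr
          exact eLpNorm_integral_fst_le hp hp' hgi
        · refine (eLpNorm_const_smul_le (c := (2 : ℝ))
            (f := fun _ : ℝ × ℝ => ∫ z, |h z| ∂squareMeasure)).trans ?_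
          rw [show ‖(2 : ℝ)‖ₑ = 2 by simp [enorm_eq_nnnorm]]
          gcongr
          rw [eLpNorm_const _ (zero_lt_one.trans_le hp).ne' (NeZero.ne _)]
          simp only [measure_univ, ENNReal.one_rpow, mul_one]
          refine le_trans ?_ (eLpNorm_le_eLpNorm_of_exponent_le hp hh.1)
          rw [eLpNorm_one_eq_lintegral_enorm]
          refine (enorm_integral_le_lintegral_enorm _).trans (le_of_eq ?_)
          simp [← ofReal_norm]

/-! ### Polynomials as functions on the square -/

lemma evalAt_add (z : ℝ × ℝ) (p q : Poly) : evalAt z (p + q) = evalAt z p + evalAt z q :=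
  map_add _ _ _

lemma evalAt_sub (z : ℝ × ℝ) (p q : Poly) : evalAt z (p - q) = evalAt z p - evalAt z q :=
  map_sub _ _ _

lemma evalAt_mul (z : ℝ × ℝ) (p q : Poly) : evalAt z (p * q) = evalAt z p * evalAt z q :=
  map_mul _ _ _

lemma hasFDerivAt_evalAt (q : Poly) (z : ℝ × ℝ) :
    HasFDerivAt (fun z => evalAt z q)
      (evalAt z (MvPolynomial.pderiv 0 q) • ContinuousLinearMap.fst ℝ ℝ ℝ +
        evalAt z (MvPolynomial.pderiv 1 q) • ContinuousLinearMap.snd ℝ ℝ ℝ) z := by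
  induction q using MvPolynomial.induction_on with
  | C a => simpa [evalAt] using hasFDerivAt_const a z
  | add p q hp hq =>
    simp only [evalAt_add, map_add]
    exact (hp.add hq).congr_fderiv (by module)
  | mul_X p i hp =>
    have hX : HasFDerivAt (fun z => evalAt z (MvPolynomial.X i))
      (evalAt z (MvPolynomial.pderiv 0 (MvPolynomial.X i)) • ContinuousLinearMap.fst ℝ ℝ ℝ +
        evalAt z (MvPolynomial.pderiv 1 (MvPolynomial.X i)) • ContinuousLinearMap.snd ℝ ℝ ℝ) z := by
      fin_cases i
      · simpa [evalAt, MvPolynomial.pderiv_X] using hasFDerivAt_fst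
      · simpa [evalAt, MvPolynomial.pderiv_X] using hasFDerivAt_snd
    simp only [evalAt_mul, MvPolynomial.pderiv_mul, evalAt_add]
    exact (hp.mul hX).congr_fderiv (by module)

lemma continuous_evalAt (q : Poly) : Continuous fun z => evalAt z q :=
  continuous_iff_continuousAt.2 fun z => (hasFDerivAt_evalAt q z).continuousAt

lemma partialX_evalAt (q : Poly) :
    partialX (fun z => evalAt z q) = fun z => evalAt z (MvPolynomial.pderiv 0 q) := by
  ext z
  simp [partialX, (hasFDerivAt_evalAt q z).fderiv]

lemma partialY_evalAt (q : Poly) :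
    partialY (fun z => evalAt z q) = fun z => evalAt z (MvPolynomial.pderiv 1 q) := by
  ext z
  simp [partialY, (hasFDerivAt_evalAt q z).fderiv]

lemma hasDerivAt_evalAt_fst (q : Poly) (x y : ℝ) :
    HasDerivAt (fun x => evalAt (x, y) q) (evalAt (x, y) (MvPolynomial.pderiv 0 q)) x := by
  have := (hasFDerivAt_evalAt q (x, y)).comp_hasDerivAt x
    ((hasDerivAt_id x).prodMk (hasDerivAt_const x y))
  exact HasDerivAt.congr_deriv this (by simp)

lemma hasDerivAt_evalAt_snd (q : Poly) (x y : ℝ) :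
    HasDerivAt (fun y => evalAt (x, y) q) (evalAt (x, y) (MvPolynomial.pderiv 1 q)) y := by
  have := (hasFDerivAt_evalAt q (x, y)).comp_hasDerivAt y
    ((hasDerivAt_const y x).prodMk (hasDerivAt_id y))
  exact HasDerivAt.congr_deriv this (by simp)

lemma isCompact_refSquare : IsCompact refSquare := isCompact_Icc.prod isCompact_Icc

lemma memLp_square_of_continuousOn {f : ℝ × ℝ → ℝ} (hf : ContinuousOn f refSquare) (p : ℝ≥0∞) :
    MemLp f p squareMeasure := by
  obtain ⟨C, hC⟩ := isCompact_refSquare.exists_bound_of_continuousOn hf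
  have hm : MeasurableSet refSquare := measurableSet_Icc.prod measurableSet_Icc
  exact MemLp.of_bound (hf.aestronglyMeasurable hm) C
    ((ae_restrict_iff' hm).2 (.of_forall hC))

lemma integrable_square_of_continuousOn {f : ℝ × ℝ → ℝ} (hf : ContinuousOn f refSquare) :
    Integrable f squareMeasure :=
  (memLp_square_of_continuousOn hf 1).integrable le_rfl

lemma memLp_evalAt (q : Poly) (p : ℝ≥0∞) : MemLp (fun z => evalAt z q) p squareMeasure :=
  memLp_square_of_continuousOn (continuous_evalAt q).continuousOn p

lemma integral_mul_deriv_add_of_isTest {g g' ψ : ℝ → ℝ} (hψ : IsTest ψ)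
    (hg : ∀ x, HasDerivAt g (g' x) x) (hg' : Continuous g') :
    ∫ x, (g x * deriv ψ x + g' x * ψ x) ∂unitMeasure = 0 := by
  have hd := (contDiff_infty_iff_deriv.1 hψ.1).1
  have h1 : ∀ x, HasDerivAt ψ (deriv ψ x) x := fun x => (hd x).hasDerivAt
  rw [integral_unitMeasure]
  have := intervalIntegral.integral_deriv_mul_eq_sub (a := 0) (b := 1) (fun x _ => h1 x)
    (fun x _ => hg x) (hψ.deriv.continuous.intervalIntegrable _ _) (hg'.intervalIntegrable _ _)
  rw [hψ.eq_zero_of_notMem (x := 1) (by simp), hψ.eq_zero_of_notMem (x := 0) (by simp)] at this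
  rw [zero_mul, zero_mul, sub_zero] at this
  rw [← this]
  congr 1 with x
  ring

lemma weakX_evalAt (q : Poly) :
    WeakX (fun z => evalAt z q) (fun z => evalAt z (MvPolynomial.pderiv 0 q)) := by
  intro ψ η hψ hη
  have hc := continuous_evalAt q
  have hc' := continuous_evalAt (MvPolynomial.pderiv 0 q)
  have hψc := hψ.continuous
  have hψc' := hψ.deriv.continuous
  have hηc := hη.continuous
  have hi := integrable_square_of_continuousOn (f := fun z =>
    (evalAt z q * deriv ψ z.1 + evalAt z (MvPolynomial.pderiv 0 q) * ψ z.1) * η z.2)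
    (by fun_prop)
  rw [squareMeasure_eq_prod] at hi ⊢
  rw [integral_prod_symm _ hi]
  refine integral_eq_zero_of_ae (.of_forall fun y => ?_)
  simp only [Pi.zero_apply]
  rw [integral_mul_const, integral_mul_deriv_add_of_isTest hψ
    (fun x => hasDerivAt_evalAt_fst q x y) (by fun_prop), zero_mul]

lemma weakY_evalAt (q : Poly) :
    WeakY (fun z => evalAt z q) (fun z => evalAt z (MvPolynomial.pderiv 1 q)) := by
  intro ψ η hψ hη
  have hc := continuous_evalAt q
  have hc' := continuous_evalAt (MvPolynomial.pderiv 1 q)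
  have hψc := hψ.continuous
  have hηc' := hη.deriv.continuous
  have hηc := hη.continuous
  have hi := integrable_square_of_continuousOn (f := fun z =>
    (evalAt z q * deriv η z.2 + evalAt z (MvPolynomial.pderiv 1 q) * η z.2) * ψ z.1)
    (by fun_prop)
  rw [squareMeasure_eq_prod] at hi ⊢
  rw [integral_prod _ hi]
  refine integral_eq_zero_of_ae (.of_forall fun x => ?_)
  simp only [Pi.zero_apply]
  rw [integral_mul_const, integral_mul_deriv_add_of_isTest hη
    (fun y => hasDerivAt_evalAt_snd q x y) (by fun_prop), zero_mul]

lemma integrable_mul_comp_isTest₂ {f : ℝ × ℝ → ℝ} (hf : Integrable f squareMeasure) {η : ℝ → ℝ}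
    (hη : IsTest η) : Integrable (fun z => f z * η z.2) squareMeasure := by
  obtain ⟨C, hC⟩ := hη.bounded
  exact hf.mul_bdd (c := C) (hη.continuous.comp continuous_snd).aestronglyMeasurable
    (.of_forall fun z => hC z.2)

lemma WeakX.sub {f g f' g' : ℝ × ℝ → ℝ} (hf : Integrable f squareMeasure)
    (hg : Integrable g squareMeasure) (hf' : Integrable f' squareMeasure)
    (hg' : Integrable g' squareMeasure) (H : WeakX f g) (H' : WeakX f' g') :
    WeakX (fun z => f z - f' z) (fun z => g z - g' z) := by
  intro ψ η hψ hη
  rw [← sub_self (0 : ℝ)]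
  nth_rw 1 [← H ψ η hψ hη]
  rw [← H' ψ η hψ hη, ← integral_sub]
  · congr 1 with z
    ring
  all_goals
    refine integrable_mul_comp_isTest₂ (.add ?_ ?_) hη
    · exact integrable_mul_comp_isTest (by assumption) hψ.deriv
    · exact integrable_mul_comp_isTest (by assumption) hψ

lemma WeakY.sub {f g f' g' : ℝ × ℝ → ℝ} (hf : Integrable f squareMeasure)
    (hg : Integrable g squareMeasure) (hf' : Integrable f' squareMeasure)
    (hg' : Integrable g' squareMeasure) (H : WeakY f g) (H' : WeakY f' g') :
    WeakY (fun z => f z - f' z) (fun z => g z - g' z) := by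
  intro ψ η hψ hη
  rw [← sub_self (0 : ℝ)]
  nth_rw 1 [← H ψ η hψ hη]
  rw [← H' ψ η hψ hη, ← integral_sub]
  · congr 1 with z
    ring
  all_goals
    refine integrable_mul_comp_isTest (.add ?_ ?_) hψ
    · exact integrable_mul_comp_isTest₂ (by assumption) hη.deriv
    · exact integrable_mul_comp_isTest₂ (by assumption) hη

/-! ### The Bramble-Hilbert lemma -/

/-- The polynomial partial derivative `∂_x^{α.1} ∂_y^{α.2}`. -/
noncomputable def pderivs (α : ℕ × ℕ) (q : Poly) : Poly :=
  (MvPolynomial.pderiv 0)^[α.1] ((MvPolynomial.pderiv 1)^[α.2] q)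

lemma pderiv_comm (q : Poly) :
    MvPolynomial.pderiv 0 (MvPolynomial.pderiv 1 q) =
      MvPolynomial.pderiv 1 (MvPolynomial.pderiv 0 q) := by
  ext m
  simp [MvPolynomial.coeff_pderiv, add_right_comm m]
  ring

lemma pderivs_succ_fst (a b : ℕ) (q : Poly) :
    pderivs (a + 1, b) q = MvPolynomial.pderiv 0 (pderivs (a, b) q) := by
  simp only [pderivs, Function.iterate_succ_apply']

lemma pderivs_succ_snd (a b : ℕ) (q : Poly) :
    pderivs (a, b + 1) q = MvPolynomial.pderiv 1 (pderivs (a, b) q) := by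
  simp only [pderivs, Function.iterate_succ_apply']
  have h : Function.Commute (MvPolynomial.pderiv 1 : Poly → Poly) (MvPolynomial.pderiv 0) :=
    fun q => (pderiv_comm q).symm
  exact (h.iterate_right a _).symm

lemma iterate_pderiv_X_pow_mul {i : Fin 2} {q : Poly} (hq : MvPolynomial.pderiv i q = 0)
    (m n : ℕ) : (MvPolynomial.pderiv i)^[n] (MvPolynomial.X i ^ m * q) =
      MvPolynomial.C (m.descFactorial n : ℝ) * (MvPolynomial.X i ^ (m - n) * q) := by
  induction n with
  | zero => simp
  | succ n ih =>
    rw [Function.iterate_succ_apply', ih, MvPolynomial.pderiv_C_mul, MvPolynomial.pderiv_mul, hq,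
      MvPolynomial.pderiv_pow, MvPolynomial.pderiv_X_self, Nat.descFactorial_succ, ← Nat.sub_sub]
    simp
    ring

lemma pderivs_monomial {i j a b : ℕ} (c : ℝ) (h : i + j = a + b) :
    pderivs (a, b) (MvPolynomial.C c * (MvPolynomial.X 0 ^ i * MvPolynomial.X 1 ^ j)) =
      if (i, j) = (a, b) then MvPolynomial.C (c * (a.factorial * b.factorial : ℝ)) else 0 := by
  have h1 : (MvPolynomial.pderiv 1 : Poly → Poly)^[b]
      (MvPolynomial.C c * (MvPolynomial.X 0 ^ i * MvPolynomial.X 1 ^ j)) =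
      MvPolynomial.C (j.descFactorial b : ℝ) * (MvPolynomial.X 1 ^ (j - b) *
        (MvPolynomial.C c * MvPolynomial.X 0 ^ i)) := by
    rw [← iterate_pderiv_X_pow_mul]
    · congr 1
      ring
    · rw [MvPolynomial.pderiv_C_mul, MvPolynomial.pderiv_pow,
        MvPolynomial.pderiv_X_of_ne (by decide)]
      simp
  have h2 : (MvPolynomial.pderiv 0 : Poly → Poly)^[a]
      (MvPolynomial.C (j.descFactorial b : ℝ) * (MvPolynomial.X 1 ^ (j - b) *
        (MvPolynomial.C c * MvPolynomial.X 0 ^ i))) =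
      MvPolynomial.C (i.descFactorial a : ℝ) * (MvPolynomial.X 0 ^ (i - a) *
        (MvPolynomial.C (j.descFactorial b : ℝ) * (MvPolynomial.C c *
          MvPolynomial.X 1 ^ (j - b)))) := by
    have hq : MvPolynomial.pderiv 0 (MvPolynomial.C (j.descFactorial b : ℝ) *
        (MvPolynomial.C c * MvPolynomial.X 1 ^ (j - b)) : Poly) = 0 := by
      rw [MvPolynomial.pderiv_C_mul, MvPolynomial.pderiv_C_mul, MvPolynomial.pderiv_pow,
        MvPolynomial.pderiv_X_of_ne (by decide)]
      simp
    rw [← iterate_pderiv_X_pow_mul hq]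
    congr 1
    ring
  rw [pderivs, h1, h2]
  split_ifs with hab
  · obtain ⟨rfl, rfl⟩ := Prod.mk.inj hab
    simp [Nat.descFactorial_self]
    ring
  · rcases Nat.lt_or_ge i a with hia | hia
    · simp [Nat.descFactorial_of_lt hia]
    · have hjb : j < b := by
        by_contra hjb
        refine hab ?_
        rw [Prod.mk.injEq]
        omega
      simp [Nat.descFactorial_of_lt hjb]

/-- A polynomial of degree at most `n` is free to have any constants as its derivatives of
order `n`. -/
lemma exists_pderivs_eq (n : ℕ) (c : ℕ × ℕ → ℝ) :
    ∃ r : Poly, r.totalDegree ≤ n ∧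
      ∀ α ∈ Finset.HasAntidiagonal.antidiagonal n, pderivs α r = MvPolynomial.C (c α) := by
  refine ⟨∑ β ∈ Finset.HasAntidiagonal.antidiagonal n,
    MvPolynomial.C (c β / (β.1.factorial * β.2.factorial)) *
      (MvPolynomial.X 0 ^ β.1 * MvPolynomial.X 1 ^ β.2), ?_, ?_⟩
  · refine MvPolynomial.totalDegree_finsetSum_le fun β hβ => ?_
    rw [Finset.HasAntidiagonal.mem_antidiagonal] at hβ
    refine (MvPolynomial.totalDegree_mul _ _).trans ?_
    rw [MvPolynomial.totalDegree_C, zero_add, ← hβ]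
    refine (MvPolynomial.totalDegree_mul _ _).trans ?_
    gcongr <;> exact MvPolynomial.totalDegree_X_pow _ _ |>.le
  · rintro ⟨a, b⟩ hα
    rw [Finset.HasAntidiagonal.mem_antidiagonal] at hα
    have hsum : ∀ (s : Finset (ℕ × ℕ)) (f : ℕ × ℕ → Poly),
        pderivs (a, b) (∑ β ∈ s, f β) = ∑ β ∈ s, pderivs (a, b) (f β) := by
      intro s f
      simp only [pderivs, ← Derivation.coeFn_coe, ← Module.End.pow_apply, map_sum]
    rw [hsum, Finset.sum_eq_single (a, b)]
    · rw [pderivs_monomial _ rfl, if_pos rfl, div_mul_cancel₀]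
      positivity
    · rintro ⟨i, j⟩ hβ hne
      rw [Finset.HasAntidiagonal.mem_antidiagonal] at hβ
      rw [pderivs_monomial _ (hβ.trans hα.symm), if_neg hne]
    · intro h
      exact absurd (Finset.HasAntidiagonal.mem_antidiagonal.2 hα) h

/-- `D` is the family of the weak derivatives of order at most `ℓ` of the function `D (0, 0)`, all
of them in `L^p`; each is linked to the preceding ones by first order weak derivatives. -/
def IsJet (ℓ : ℕ) (p : ℝ≥0∞) (D : ℕ × ℕ → ℝ × ℝ → ℝ) : Prop :=
  (∀ α : ℕ × ℕ, α.1 + α.2 ≤ ℓ → MemLp (D α) p squareMeasure) ∧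
    ∀ a b, a + b < ℓ → WeakX (D (a, b)) (D (a + 1, b)) ∧ WeakY (D (a, b)) (D (a, b + 1))

lemma IsJet.sub_evalAt {ℓ m : ℕ} {p : ℝ≥0∞} {D : ℕ × ℕ → ℝ × ℝ → ℝ} (h : IsJet ℓ p D)
    (hp : 1 ≤ p) (hm : m ≤ ℓ) (r : Poly) :
    IsJet m p (fun α z => D α z - evalAt z (pderivs α r)) := by
  have hi : ∀ α : ℕ × ℕ, α.1 + α.2 ≤ ℓ → Integrable (D α) squareMeasure :=
    fun α hα => (h.1 α hα).integrable hp
  have hr : ∀ q : Poly, Integrable (fun z => evalAt z q) squareMeasure :=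
    fun q => (memLp_evalAt q 1).integrable le_rfl
  refine ⟨fun α hα => (h.1 α (hα.trans hm)).sub (memLp_evalAt _ p), fun a b hab => ⟨?_, ?_⟩⟩
  · simp only [pderivs_succ_fst]
    exact (h.2 a b (by omega)).1.sub (hi _ (by simp only; omega)) (hi _ (by simp only; omega))
      (hr _) (hr _) (weakX_evalAt _)
  · simp only [pderivs_succ_snd]
    exact (h.2 a b (by omega)).2.sub (hi _ (by simp only; omega)) (hi _ (by simp only; omega))
      (hr _) (hr _) (weakY_evalAt _)

/-- The Bramble-Hilbert lemma: up to a polynomial of degree less than `ℓ`, a function is controlled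
in `L^p` by its weak derivatives of order `ℓ`. The hypothesis `ℓ ≤ m + 1` expresses `ℓ - 1 ≤ m`,
so that the polynomial vanishes for `ℓ = 0`. -/
theorem exists_eLpNorm_sub_evalAt_le {p : ℝ≥0∞} (hp : 1 ≤ p) (hp' : p ≠ ∞) (ℓ : ℕ) :
    ∃ C : ℝ≥0, ∀ D : ℕ × ℕ → ℝ × ℝ → ℝ, IsJet ℓ p D →
      ∃ q : Poly, (∀ m, ℓ ≤ m + 1 → q.totalDegree ≤ m) ∧
        eLpNorm (fun z => D (0, 0) z - evalAt z q) p squareMeasure ≤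
          C * ∑ α ∈ Finset.HasAntidiagonal.antidiagonal ℓ, eLpNorm (D α) p squareMeasure := by
  induction ℓ with
  | zero =>
    refine ⟨1, fun D _ => ⟨0, fun m _ => by simp, ?_⟩⟩
    simp [evalAt]
  | succ ℓ ih =>
    obtain ⟨C, hC⟩ := ih
    refine ⟨C * 4, fun D hD => ?_⟩
    -- after subtracting `r`, the derivatives of order `ℓ` have mean zero
    obtain ⟨r, hr, hrD⟩ := exists_pderivs_eq ℓ fun α => ∫ z, D α z ∂squareMeasure
    obtain ⟨q, hq, hqD⟩ := hC _ (hD.sub_evalAt hp ℓ.le_succ r)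
    refine ⟨r + q, fun m hm => ?_, ?_⟩
    · exact (MvPolynomial.totalDegree_add _ _).trans (max_le (by omega) (hq m (by omega)))
    have e : (fun z => D (0, 0) z - evalAt z (r + q)) =
        fun z => D (0, 0) z - evalAt z (pderivs (0, 0) r) - evalAt z q := by
      ext z
      rw [evalAt_add]
      simp only [pderivs, Function.iterate_zero, id]
      ring
    rw [e]
    refine hqD.trans ?_
    rw [ENNReal.coe_mul, mul_assoc]
    gcongr
    calc _ ≤ ∑ α ∈ Finset.HasAntidiagonal.antidiagonal ℓ, (2 * eLpNorm (D (α.1 + 1, α.2)) p squareMeasure +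
          2 * eLpNorm (D (α.1, α.2 + 1)) p squareMeasure) := by
          refine Finset.sum_le_sum fun α hα => ?_
          simp only [hrD α hα]
          obtain ⟨a, b⟩ := α
          rw [Finset.HasAntidiagonal.mem_antidiagonal] at hα
          simp only [evalAt, MvPolynomial.eval_C]
          simp only at hα
          exact eLpNorm_sub_integral_le hp hp' (hD.1 _ (by simp only; omega))
            (hD.1 _ (by simp only; omega)) (hD.1 _ (by simp only; omega))
            (hD.2 a b (by omega)).1 (hD.2 a b (by omega)).2
      _ ≤ 2 * ∑ α ∈ Finset.HasAntidiagonal.antidiagonal (ℓ + 1), eLpNorm (D α) p squareMeasure +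
          2 * ∑ α ∈ Finset.HasAntidiagonal.antidiagonal (ℓ + 1), eLpNorm (D α) p squareMeasure := by
          rw [Finset.sum_add_distrib, ← Finset.mul_sum, ← Finset.mul_sum]
          gcongr
          · rw [Finset.Nat.sum_antidiagonal_succ (f := fun α => eLpNorm (D α) p squareMeasure)]
            exact le_add_self
          · rw [Finset.Nat.sum_antidiagonal_succ' (f := fun α => eLpNorm (D α) p squareMeasure)]
            exact le_add_self
      _ = _ := by
          push_cast
          ring

/-! ### Products of one-dimensional test functions -/

/-- The product `ψ(x) η(y)` of two test functions on the unit interval, as a test function on the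
open unit square. -/
noncomputable def tensorTest {ψ η : ℝ → ℝ} (hψ : IsTest ψ) (hη : IsTest η) :
    𝓓(openSquare, ℝ) where
  toFun z := ψ z.1 * η z.2
  contDiff' := (hψ.1.comp contDiff_fst).mul (hη.1.comp contDiff_snd)
  hasCompactSupport' := by
    refine HasCompactSupport.of_support_subset_isCompact
      (hψ.2.1.isCompact.prod hη.2.1.isCompact) fun z hz => ?_
    exact ⟨subset_tsupport _ (left_ne_zero_of_mul hz), subset_tsupport _ (right_ne_zero_of_mul hz)⟩
  tsupport_subset' := by
    have : tsupport (fun z : ℝ × ℝ => ψ z.1 * η z.2) ⊆ tsupport ψ ×ˢ tsupport η := by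
      refine closure_minimal (fun z hz => ?_) ((isClosed_tsupport _).prod (isClosed_tsupport _))
      exact ⟨subset_tsupport _ (left_ne_zero_of_mul hz),
        subset_tsupport _ (right_ne_zero_of_mul hz)⟩
    exact this.trans (prod_mono hψ.2.2 hη.2.2)

lemma coe_tensorTest {ψ η : ℝ → ℝ} (hψ : IsTest ψ) (hη : IsTest η) :
    (tensorTest hψ hη : ℝ × ℝ → ℝ) = fun z => ψ z.1 * η z.2 := rfl

lemma IsTest.differentiable {ψ : ℝ → ℝ} (hψ : IsTest ψ) : Differentiable ℝ ψ :=
  (contDiff_infty_iff_deriv.1 hψ.1).1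

lemma hasFDerivAt_mul_prod {ψ η : ℝ → ℝ} (hψ : Differentiable ℝ ψ) (hη : Differentiable ℝ η)
    (z : ℝ × ℝ) :
    HasFDerivAt (fun z : ℝ × ℝ => ψ z.1 * η z.2)
      ((deriv ψ z.1 * η z.2) • ContinuousLinearMap.fst ℝ ℝ ℝ +
        (ψ z.1 * deriv η z.2) • ContinuousLinearMap.snd ℝ ℝ ℝ) z := by
  have h1 := (hψ z.1).hasDerivAt.comp_hasFDerivAt z
    (hasFDerivAt_fst (𝕜 := ℝ) (E := ℝ) (F := ℝ) (p := z))
  have h2 := (hη z.2).hasDerivAt.comp_hasFDerivAt z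
    (hasFDerivAt_snd (𝕜 := ℝ) (E := ℝ) (F := ℝ) (p := z))
  exact (h1.mul h2).congr_fderiv (by simp only [Function.comp]; module)

lemma partialX_mul_prod {ψ η : ℝ → ℝ} (hψ : Differentiable ℝ ψ) (hη : Differentiable ℝ η) :
    partialX (fun z : ℝ × ℝ => ψ z.1 * η z.2) = fun z => deriv ψ z.1 * η z.2 := by
  ext z
  simp [partialX, (hasFDerivAt_mul_prod hψ hη z).fderiv]

lemma partialY_mul_prod {ψ η : ℝ → ℝ} (hψ : Differentiable ℝ ψ) (hη : Differentiable ℝ η) :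
    partialY (fun z : ℝ × ℝ => ψ z.1 * η z.2) = fun z => ψ z.1 * deriv η z.2 := by
  ext z
  simp [partialY, (hasFDerivAt_mul_prod hψ hη z).fderiv]

lemma iterate_partial_mul_prod {ψ η : ℝ → ℝ} (hψ : IsTest ψ) (hη : IsTest η) (a b : ℕ) :
    partialX^[a] (partialY^[b] (fun z : ℝ × ℝ => ψ z.1 * η z.2)) =
      fun z => deriv^[a] ψ z.1 * deriv^[b] η z.2 := by
  have hb : partialY^[b] (fun z : ℝ × ℝ => ψ z.1 * η z.2) = fun z => ψ z.1 * deriv^[b] η z.2 := by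
    induction b with
    | zero => rfl
    | succ b ih =>
      rw [Function.iterate_succ_apply', ih, Function.iterate_succ_apply',
        partialY_mul_prod hψ.differentiable (hη.iterate_deriv b).differentiable]
  rw [hb]
  induction a with
  | zero => rfl
  | succ a ih =>
    rw [Function.iterate_succ_apply', ih, Function.iterate_succ_apply',
      partialX_mul_prod (hψ.iterate_deriv a).differentiable (hη.iterate_deriv b).differentiable]

lemma HasWeakPartial.integral_mul_prod {α : ℕ × ℕ} {f g : ℝ × ℝ → ℝ} (h : HasWeakPartial α f g)
    {ψ η : ℝ → ℝ} (hψ : IsTest ψ) (hη : IsTest η) :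
    ∫ z, f z * (deriv^[α.1] ψ z.1 * deriv^[α.2] η z.2) ∂squareMeasure =
      (-1) ^ (α.1 + α.2) * ∫ z, g z * (ψ z.1 * η z.2) ∂squareMeasure := by
  have := h.2.2 (tensorTest hψ hη)
  rw [coe_tensorTest, iterate_partial_mul_prod hψ hη] at this
  exact this

lemma HasWeakPartial.weakX {a b : ℕ} {f g h : ℝ × ℝ → ℝ} (hg : HasWeakPartial (a, b) f g)
    (hh : HasWeakPartial (a + 1, b) f h) (hgi : Integrable g squareMeasure)
    (hhi : Integrable h squareMeasure) : WeakX g h := by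
  intro ψ η hψ hη
  have h1 := hg.integral_mul_prod hψ.deriv hη
  have h2 := hh.integral_mul_prod hψ hη
  simp only [← Function.iterate_succ_apply] at h1
  rw [h1] at h2
  have h3 : ∫ z, g z * (deriv ψ z.1 * η z.2) ∂squareMeasure =
      -∫ z, h z * (ψ z.1 * η z.2) ∂squareMeasure := by
    refine mul_left_cancel₀ (pow_ne_zero (a + b) (neg_ne_zero.2 (one_ne_zero' ℝ))) ?_
    rw [h2, add_right_comm, pow_succ]
    ring
  simp_rw [add_mul, mul_assoc]
  rw [integral_add, h3, neg_add_cancel]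
  · simpa only [mul_assoc] using
      integrable_mul_comp_isTest₂ (integrable_mul_comp_isTest hgi hψ.deriv) hη
  · simpa only [mul_assoc] using
      integrable_mul_comp_isTest₂ (integrable_mul_comp_isTest hhi hψ) hη

lemma HasWeakPartial.weakY {a b : ℕ} {f g h : ℝ × ℝ → ℝ} (hg : HasWeakPartial (a, b) f g)
    (hh : HasWeakPartial (a, b + 1) f h) (hgi : Integrable g squareMeasure)
    (hhi : Integrable h squareMeasure) : WeakY g h := by
  intro ψ η hψ hη
  have h1 := hg.integral_mul_prod hψ hη.deriv
  have h2 := hh.integral_mul_prod hψ hη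
  simp only [← Function.iterate_succ_apply] at h1
  rw [h1] at h2
  have h3 : ∫ z, g z * (ψ z.1 * deriv η z.2) ∂squareMeasure =
      -∫ z, h z * (ψ z.1 * η z.2) ∂squareMeasure := by
    refine mul_left_cancel₀ (pow_ne_zero (a + b) (neg_ne_zero.2 (one_ne_zero' ℝ))) ?_
    rw [h2, ← add_assoc, pow_succ]
    ring
  simp_rw [add_mul, mul_assoc, mul_comm (deriv η _), mul_comm (η _)]
  rw [integral_add, h3, neg_add_cancel]
  · simpa only [mul_assoc] using
      integrable_mul_comp_isTest₂ (integrable_mul_comp_isTest hgi hψ) hη.deriv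
  · simpa only [mul_assoc] using
      integrable_mul_comp_isTest₂ (integrable_mul_comp_isTest hhi hψ) hη

lemma squareMeasure_eq_restrict_openSquare :
    squareMeasure = volume.restrict (openSquare : Set (ℝ × ℝ)) := by
  rw [squareMeasure_eq_prod, unitMeasure, ← restrict_Ioo_eq_restrict_Icc, Measure.prod_restrict,
    ← Measure.volume_eq_prod]
  rfl

lemma HasWeakPartial.aestronglyMeasurable {α : ℕ × ℕ} {f g : ℝ × ℝ → ℝ}
    (h : HasWeakPartial α f g) : AEStronglyMeasurable g squareMeasure := by
  rw [squareMeasure_eq_restrict_openSquare]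
  exact h.2.1.aestronglyMeasurable

/-- The weak derivatives of a Sobolev function form a jet, with prescribed representatives of the
derivatives of top order. -/
lemma MemSobolev.exists_isJet {ℓ : ℕ} {p : ℝ≥0∞} {w : ℝ × ℝ → ℝ} (hw : MemSobolev ℓ p w)
    (hℓ : 1 ≤ ℓ) (hp : 1 ≤ p) {D : ℕ × ℕ → ℝ × ℝ → ℝ}
    (hD : ∀ α ∈ Finset.HasAntidiagonal.antidiagonal ℓ, HasWeakPartial α w (D α))
    (hDp : ∀ α ∈ Finset.HasAntidiagonal.antidiagonal ℓ, MemLp (D α) p squareMeasure) :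
    ∃ E : ℕ × ℕ → ℝ × ℝ → ℝ, IsJet ℓ p E ∧ E (0, 0) = w ∧
      ∀ α ∈ Finset.HasAntidiagonal.antidiagonal ℓ, E α = D α := by
  obtain ⟨hwp, hex⟩ := hw
  have hE : ∀ α : ℕ × ℕ, ∃ g, (α.1 + α.2 ≤ ℓ → HasWeakPartial α w g ∧ MemLp g p squareMeasure) ∧
      (α = (0, 0) → g = w) ∧ (α ∈ Finset.HasAntidiagonal.antidiagonal ℓ → g = D α) := by
    intro α
    by_cases h0 : α = (0, 0)
    · subst h0
      refine ⟨w, fun _ => ⟨?_, hwp⟩, fun _ => rfl, fun h => ?_⟩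
      · obtain ⟨g, hg, -⟩ := hex (0, 0) (by simp)
        exact ⟨hg.1, hg.1, fun φ => by simp⟩
      · rw [Finset.HasAntidiagonal.mem_antidiagonal] at h
        simp only at h
        omega
    · by_cases hα : α ∈ Finset.HasAntidiagonal.antidiagonal ℓ
      · exact ⟨D α, fun _ => ⟨hD α hα, hDp α hα⟩, fun h => absurd h h0, fun _ => rfl⟩
      · by_cases hle : α.1 + α.2 ≤ ℓ
        · obtain ⟨g, hg⟩ := hex α hle
          exact ⟨g, fun _ => hg, fun h => absurd h h0, fun h => absurd h hα⟩
        · exact ⟨0, fun h => absurd h hle, fun h => absurd h h0, fun h => absurd h hα⟩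
  choose E h1 h2 h3 using hE
  refine ⟨E, ⟨fun α hα => (h1 α hα).2, fun a b hab => ⟨?_, ?_⟩⟩, h2 _ rfl, h3⟩
  · have e1 := h1 (a, b) (by simp only; omega)
    have e2 := h1 (a + 1, b) (by simp only; omega)
    exact e1.1.weakX e2.1 (e1.2.integrable hp) (e2.2.integrable hp)
  · have e1 := h1 (a, b) (by simp only; omega)
    have e2 := h1 (a, b + 1) (by simp only; omega)
    exact e1.1.weakY e2.1 (e1.2.integrable hp) (e2.2.integrable hp)

/-! ### Green's formula up to the boundary -/

lemma integrable_mul_continuous {f g : ℝ × ℝ → ℝ} (hf : Integrable f squareMeasure)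
    (hg : Continuous g) : Integrable (fun z => f z * g z) squareMeasure := by
  obtain ⟨C, hC⟩ := isCompact_refSquare.exists_bound_of_continuousOn hg.continuousOn
  have hm : MeasurableSet refSquare := measurableSet_Icc.prod measurableSet_Icc
  exact hf.mul_bdd (c := C) hg.aestronglyMeasurable ((ae_restrict_iff' hm).2 (.of_forall hC))

lemma integral_square_fst {A B : ℝ × ℝ → ℝ} (hA : Integrable A squareMeasure)
    (hB : Integrable B squareMeasure) {p q : ℝ → ℝ} (hp : Continuous p) (hq : Continuous q) :
    ∫ z, (A z * p z.1 + B z * q z.1) ∂squareMeasure =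
      ∫ x, ((∫ y, A (x, y) ∂unitMeasure) * p x + (∫ y, B (x, y) ∂unitMeasure) * q x)
        ∂unitMeasure := by
  have h : Integrable (fun z : ℝ × ℝ => A z * p z.1 + B z * q z.1) squareMeasure :=
    (integrable_mul_continuous hA (hp.comp continuous_fst)).add
      (integrable_mul_continuous hB (hq.comp continuous_fst))
  rw [squareMeasure_eq_prod] at *
  rw [integral_prod _ h]
  refine integral_congr_ae ?_
  filter_upwards [hA.prod_right_ae, hB.prod_right_ae] with x h1 h2
  rw [integral_add (h1.mul_const _) (h2.mul_const _), integral_mul_const, integral_mul_const]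

lemma integral_square_snd {A B : ℝ × ℝ → ℝ} (hA : Integrable A squareMeasure)
    (hB : Integrable B squareMeasure) {p q : ℝ → ℝ} (hp : Continuous p) (hq : Continuous q) :
    ∫ z, (A z * p z.2 + B z * q z.2) ∂squareMeasure =
      ∫ y, ((∫ x, A (x, y) ∂unitMeasure) * p y + (∫ x, B (x, y) ∂unitMeasure) * q y)
        ∂unitMeasure := by
  rw [← integral_comp_swap_square]
  exact integral_square_fst (A := fun z => A z.swap) (B := fun z => B z.swap)
    (measurePreserving_swap_square.integrable_comp_of_integrable hA)
    (measurePreserving_swap_square.integrable_comp_of_integrable hB) hp hq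

lemma continuous_integral_snd {f : ℝ × ℝ → ℝ} (hf : Continuous f) :
    Continuous fun x => ∫ y, f (x, y) ∂unitMeasure := by
  have e : (fun x => ∫ y, f (x, y) ∂unitMeasure) = fun x => ∫ y in (0 : ℝ)..1, f (x, y) :=
    funext fun x => integral_unitMeasure fun y => f (x, y)
  rw [e]
  exact intervalIntegral.continuous_parametric_intervalIntegral_of_continuous' (by exact hf) 0 1

lemma integrable_integral_snd {f : ℝ × ℝ → ℝ} (hf : Integrable f squareMeasure) :
    Integrable (fun x => ∫ y, f (x, y) ∂unitMeasure) unitMeasure := by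
  rw [squareMeasure_eq_prod] at hf
  exact hf.integral_prod_left

lemma integrable_integral_fst {f : ℝ × ℝ → ℝ} (hf : Integrable f squareMeasure) :
    Integrable (fun y => ∫ x, f (x, y) ∂unitMeasure) unitMeasure := by
  rw [squareMeasure_eq_prod] at hf
  exact hf.integral_prod_right

/-- Green's formula for a continuous vector field `(a, b)` with integrable weak divergence `w` and
the functions `ψ(x) η(y)`, which need not vanish on the boundary. It results from integrating by
parts in one variable at a time. -/
theorem green_formula {a b w : ℝ × ℝ → ℝ} (ha : Continuous a) (hb : Continuous b)
    (hw : Integrable w squareMeasure)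
    (h : ∀ ψ η, IsTest ψ → IsTest η →
      ∫ z, (a z * (deriv ψ z.1 * η z.2) + b z * (ψ z.1 * deriv η z.2) +
        w z * (ψ z.1 * η z.2)) ∂squareMeasure = 0)
    {ψ η : ℝ → ℝ} (hψ : ContDiff ℝ 1 ψ) (hη : ContDiff ℝ 1 η) :
    ∫ z, (a z * (deriv ψ z.1 * η z.2) + b z * (ψ z.1 * deriv η z.2) +
        w z * (ψ z.1 * η z.2)) ∂squareMeasure =
      (∫ y, (a (1, y) * ψ 1 - a (0, y) * ψ 0) * η y ∂unitMeasure) +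
      ((∫ x, b (x, 1) * ψ x ∂unitMeasure) * η 1 - (∫ x, b (x, 0) * ψ x ∂unitMeasure) * η 0) := by
  have hai := integrable_square_of_continuousOn ha.continuousOn
  have hbi := integrable_square_of_continuousOn hb.continuousOn
  have hψc := hψ.continuous
  have hψc' : Continuous (deriv ψ) := hψ.continuous_deriv le_rfl
  -- integration by parts in the first variable
  have step1 : ∀ η, IsTest η →
      ∫ z, (a z * (deriv ψ z.1 * η z.2) + b z * (ψ z.1 * deriv η z.2) +
        w z * (ψ z.1 * η z.2)) ∂squareMeasure =
      ∫ y, (a (1, y) * ψ 1 - a (0, y) * ψ 0) * η y ∂unitMeasure := by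
    intro η hη
    have hηc := hη.continuous
    have hηc' := hη.deriv.continuous
    have hA : Integrable (fun z => a z * η z.2) squareMeasure :=
      integrable_mul_continuous hai (hηc.comp continuous_snd)
    have hB : Integrable (fun z => b z * deriv η z.2 + w z * η z.2) squareMeasure :=
      (integrable_mul_continuous hbi (hηc'.comp continuous_snd)).add
        (integrable_mul_continuous hw (hηc.comp continuous_snd))
    have e : ∀ {p q : ℝ → ℝ}, Continuous p → Continuous q →
        ∫ z, (a z * (p z.1 * η z.2) + b z * (q z.1 * deriv η z.2) +
          w z * (q z.1 * η z.2)) ∂squareMeasure = _ :=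
      fun {p q} hp hq => (by
        congr 1 with z
        ring : _ = ∫ z, (a z * η z.2 * p z.1 + (b z * deriv η z.2 + w z * η z.2) * q z.1)
            ∂squareMeasure).trans (integral_square_fst hA hB hp hq)
    rw [e hψc' hψc]
    have hcU : Continuous fun x => ∫ y, a (x, y) * η y ∂unitMeasure :=
      continuous_integral_snd (f := fun z => a z * η z.2) (by fun_prop)
    rw [integral_by_parts_of_weak_deriv hcU.continuousOn (integrable_integral_snd hB) ?_ hψ]
    · rw [← integral_mul_const, ← integral_mul_const, ← integral_sub]
      · congr 1 with y
        ring
      · exact integrable_unitMeasure_of_continuousOn (by fun_prop)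
      · exact integrable_unitMeasure_of_continuousOn (by fun_prop)
    · intro θ hθ
      rw [← e hθ.deriv.continuous hθ.continuous]
      exact h θ η hθ hη
  -- integration by parts in the second variable
  have hB2 : Integrable (fun z => b z * ψ z.1) squareMeasure :=
    integrable_mul_continuous hbi (hψc.comp continuous_fst)
  have hA2 : Integrable (fun z => a z * deriv ψ z.1 + w z * ψ z.1) squareMeasure :=
    (integrable_mul_continuous hai (hψc'.comp continuous_fst)).add
      (integrable_mul_continuous hw (hψc.comp continuous_fst))
  have hbd : Continuous fun y => a (1, y) * ψ 1 - a (0, y) * ψ 0 := by fun_prop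
  have hcU : Continuous fun y => ∫ x, b (x, y) * ψ x ∂unitMeasure :=
    continuous_integral_snd (f := fun z => b z.swap * ψ z.2) (by fun_prop)
  have hV : Integrable (fun y => ∫ x, (a (x, y) * deriv ψ x + w (x, y) * ψ x) ∂unitMeasure)
      unitMeasure := integrable_integral_fst hA2
  have e : ∀ {p q : ℝ → ℝ}, Continuous p → Continuous q →
      ∫ z, (a z * (deriv ψ z.1 * q z.2) + b z * (ψ z.1 * p z.2) +
        w z * (ψ z.1 * q z.2)) ∂squareMeasure =
      (∫ y, ((∫ x, b (x, y) * ψ x ∂unitMeasure) * p y +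
        ((∫ x, (a (x, y) * deriv ψ x + w (x, y) * ψ x) ∂unitMeasure) -
          (a (1, y) * ψ 1 - a (0, y) * ψ 0)) * q y) ∂unitMeasure) +
        ∫ y, (a (1, y) * ψ 1 - a (0, y) * ψ 0) * q y ∂unitMeasure := by
    intro p q hp hq
    have e1 : ∫ z, (a z * (deriv ψ z.1 * q z.2) + b z * (ψ z.1 * p z.2) +
        w z * (ψ z.1 * q z.2)) ∂squareMeasure =
        ∫ z, (b z * ψ z.1 * p z.2 + (a z * deriv ψ z.1 + w z * ψ z.1) * q z.2)
          ∂squareMeasure := by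
      congr 1 with z
      ring
    have hm : ∀ {V q : ℝ → ℝ}, Integrable V unitMeasure → Continuous q →
        Integrable (fun y => V y * q y) unitMeasure := by
      intro V q hV hq
      obtain ⟨C, hC⟩ := isCompact_Icc.exists_bound_of_continuousOn
        (hq.continuousOn (s := Icc (0 : ℝ) 1))
      exact hV.mul_bdd (c := C) hq.aestronglyMeasurable
        ((ae_restrict_iff' measurableSet_Icc).2 (.of_forall hC))
    have hbdi := integrable_unitMeasure_of_continuousOn hbd.continuousOn
    rw [e1, integral_square_snd hB2 hA2 hp hq, ← integral_add]
    · congr 1 with y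
      ring
    · exact (hm (integrable_unitMeasure_of_continuousOn hcU.continuousOn) hp).add
        (hm (hV.sub hbdi) hq)
    · exact hm hbdi hq
  have hV' : Integrable (fun y => (∫ x, (a (x, y) * deriv ψ x + w (x, y) * ψ x) ∂unitMeasure) -
      (a (1, y) * ψ 1 - a (0, y) * ψ 0)) unitMeasure :=
    hV.sub (integrable_unitMeasure_of_continuousOn hbd.continuousOn)
  rw [e (hη.continuous_deriv le_rfl) hη.continuous,
    integral_by_parts_of_weak_deriv hcU.continuousOn hV' ?_ hη]
  · ring
  · intro θ hθ
    have h1 := step1 θ hθ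
    rw [e hθ.deriv.continuous hθ.continuous] at h1
    simpa using h1

/-! ### Factorization of polynomials vanishing on two parallel lines -/

/-- A polynomial is congruent modulo `X i - c` to the result of substituting `c` for `X i`. -/
lemma X_sub_C_dvd_sub_aeval (i : Fin 2) (c : ℝ) (p : Poly) :
    (MvPolynomial.X i - MvPolynomial.C c) ∣
      p - MvPolynomial.aeval (Function.update MvPolynomial.X i (MvPolynomial.C c)) p := by
  induction p using MvPolynomial.induction_on with
  | C a => simp [MvPolynomial.algebraMap_eq]
  | add p q hp hq =>
    rw [map_add, add_sub_add_comm]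
    exact dvd_add hp hq
  | mul_X p j hp =>
    rw [map_mul, MvPolynomial.aeval_X]
    have hX : (MvPolynomial.X i - MvPolynomial.C c : Poly) ∣ MvPolynomial.X j -
        Function.update MvPolynomial.X i (MvPolynomial.C c) j := by
      by_cases hj : j = i
      · subst hj
        simp
      · simp [Function.update_of_ne hj]
    have e : ∀ x y x' y' : Poly, x * y - x' * y' = (x - x') * y + x' * (y - y') := by
      intros; ring
    rw [e]
    exact dvd_add (hp.mul_right _) (hX.mul_left _)

lemma X_sub_C_dvd {i : Fin 2} {c : ℝ} {p : Poly}
    (h : ∀ x : Fin 2 → ℝ, x i = c → MvPolynomial.eval x p = 0) :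
    (MvPolynomial.X i - MvPolynomial.C c) ∣ p := by
  have h1 := X_sub_C_dvd_sub_aeval i c p
  have h2 : MvPolynomial.aeval (Function.update MvPolynomial.X i (MvPolynomial.C c)) p =
      (0 : Poly) := by
    refine MvPolynomial.funext fun x => ?_
    rw [map_zero, ← h (Function.update x i c) (by simp), MvPolynomial.aeval_def,
      MvPolynomial.eval_eval₂]
    rw [MvPolynomial.eval, MvPolynomial.coe_eval₂Hom]
    congr 1
    · ext a
      simp [MvPolynomial.algebraMap_eq]
    · ext j
      by_cases hj : j = i
      · subst hj
        simp
      · simp [Function.update_of_ne hj]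
  rwa [h2, sub_zero] at h1

lemma X_sub_C_ne_zero (i : Fin 2) (c : ℝ) : (MvPolynomial.X i - MvPolynomial.C c : Poly) ≠ 0 := by
  intro h
  have := congrArg (MvPolynomial.eval fun _ => c + 1) h
  simp at this

lemma totalDegree_X_sub_C (i : Fin 2) (c : ℝ) :
    (MvPolynomial.X i - MvPolynomial.C c : Poly).totalDegree = 1 := by
  refine le_antisymm ((MvPolynomial.totalDegree_sub _ _).trans (by simp)) ?_
  have h : Finsupp.single i 1 ∈ (MvPolynomial.X i - MvPolynomial.C c : Poly).support := by
    have h0 : (0 : Fin 2 →₀ ℕ) ≠ Finsupp.single i 1 := fun h0 => by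
      simpa using DFunLike.congr_fun h0 i
    rw [MvPolynomial.mem_support_iff, MvPolynomial.coeff_sub, MvPolynomial.coeff_C, if_neg h0]
    simp
  simpa using MvPolynomial.le_totalDegree h

lemma exists_eq_X_mul_X_sub_one_mul {i : Fin 2} {p : Poly}
    (h0 : ∀ x : Fin 2 → ℝ, x i = 0 → MvPolynomial.eval x p = 0)
    (h1 : ∀ x : Fin 2 → ℝ, x i = 1 → MvPolynomial.eval x p = 0) :
    ∃ r : Poly, p = MvPolynomial.X i * ((MvPolynomial.X i - 1) * r) ∧
      (r = 0 ∨ p.totalDegree = r.totalDegree + 2) := by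
  obtain ⟨s, hs⟩ := X_sub_C_dvd h0
  rw [map_zero, sub_zero] at hs
  obtain ⟨r, hr⟩ := X_sub_C_dvd (i := i) (c := 1) (p := s) fun x hx => by
    have := h1 x hx
    rw [hs, map_mul, MvPolynomial.eval_X, hx, one_mul] at this
    exact this
  refine ⟨r, by rw [hs, hr, map_one], ?_⟩
  by_cases hr0 : r = 0
  · exact Or.inl hr0
  · right
    have hX : (MvPolynomial.X i : Poly) ≠ 0 := MvPolynomial.X_ne_zero i
    rw [hs, hr, MvPolynomial.totalDegree_mul_of_isDomain hX
      (mul_ne_zero (X_sub_C_ne_zero i 1) hr0),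
      MvPolynomial.totalDegree_mul_of_isDomain (X_sub_C_ne_zero i 1) hr0,
      totalDegree_X_sub_C, MvPolynomial.totalDegree_X]
    ring

lemma coeff_eq_zero_of_lt {p : Poly} {m : Fin 2 →₀ ℕ} (h : p.totalDegree < m 0 + m 1) :
    p.coeff m = 0 := by
  refine MvPolynomial.coeff_eq_zero_of_totalDegree_lt (h.trans_le (le_of_eq ?_))
  have := Finsupp.sum_fintype m (fun _ e => e) (fun _ => rfl)
  rw [Fin.sum_univ_two] at this
  exact this.symm

/-- A polynomial of degree at most `k + 1` that vanishes on the lines `X i = 0` and `X i = 1` has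
no term `X i * X j ^ k`: it is `X i * (X i - 1)` times a polynomial of degree at most `k - 1`. -/
lemma coeff_X_mul_X_pow_eq_zero {i j : Fin 2} (hij : i ≠ j) {k : ℕ} {p : Poly}
    (hp : p.totalDegree ≤ k + 1)
    (h0 : ∀ x : Fin 2 → ℝ, x i = 0 → MvPolynomial.eval x p = 0)
    (h1 : ∀ x : Fin 2 → ℝ, x i = 1 → MvPolynomial.eval x p = 0) :
    p.coeff (Finsupp.single i 1 + Finsupp.single j k) = 0 := by
  obtain ⟨r, hr, hr'⟩ := exists_eq_X_mul_X_sub_one_mul h0 h1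
  have hc : r.coeff (Finsupp.single j k) = 0 := by
    rcases hr' with rfl | hr'
    · simp
    · refine coeff_eq_zero_of_lt ?_
      have : (Finsupp.single j k) 0 + (Finsupp.single j k) 1 = k := by
        fin_cases j <;> simp
      omega
  rw [hr, MvPolynomial.coeff_X_mul, sub_mul, one_mul, MvPolynomial.coeff_sub, hc, sub_zero,
    MvPolynomial.coeff_X_mul', if_neg]
  rw [Finsupp.mem_support_iff, not_not, Finsupp.single_apply, if_neg hij.symm]

/-! ### Polynomials determined by their integrals -/

lemma eqOn_zero_of_integral_square_eq_zero {f : ℝ × ℝ → ℝ} (hf : Continuous f)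
    (h0 : ∀ z ∈ refSquare, 0 ≤ f z) (h : ∫ z, f z ∂squareMeasure = 0) :
    ∀ z ∈ refSquare, f z = 0 := by
  have hm : MeasurableSet refSquare := measurableSet_Icc.prod measurableSet_Icc
  have h1 : ∀ᵐ z ∂squareMeasure, 0 ≤ f z := (ae_restrict_iff' hm).2 (.of_forall h0)
  have h2 := (integral_eq_zero_iff_of_nonneg_ae h1
    (integrable_square_of_continuousOn hf.continuousOn)).1 h
  refine Measure.eqOn_of_ae_eq (μ := volume) h2 hf.continuousOn continuousOn_const ?_
  rw [refSquare, interior_prod_eq, closure_prod_eq, interior_Icc, closure_Ioo zero_ne_one]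

lemma eq_zero_of_evalAt_eq_zero {q : Poly}
    (h : ∀ x ∈ Ioo (0 : ℝ) 1, ∀ y ∈ Ioo (0 : ℝ) 1, evalAt (x, y) q = 0) : q = 0 := by
  refine MvPolynomial.funext_set (fun _ => Ioo (0 : ℝ) 1)
    (fun _ => Ioo_infinite zero_lt_one) fun x hx => ?_
  have := h (x 0) (hx 0 trivial) (x 1) (hx 1 trivial)
  have e : ![x 0, x 1] = x := by ext i; fin_cases i <;> rfl
  simpa [evalAt, e] using this

lemma eq_zero_of_integral_mul_self_eq_zero {P : Polynomial ℝ}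
    (h : ∫ t in (0 : ℝ)..1, P.eval t * P.eval t = 0) : P = 0 := by
  rw [← integral_unitMeasure fun t => P.eval t * P.eval t] at h
  have hi : Integrable (fun t => P.eval t * P.eval t) unitMeasure :=
    integrable_unitMeasure_of_continuousOn (by fun_prop)
  have h2 := (integral_eq_zero_iff_of_nonneg (fun t => mul_self_nonneg (P.eval t)) hi).1 h
  have h3 := Measure.eqOn_Icc_of_ae_eq (μ := volume) zero_ne_one h2 (by fun_prop)
    continuousOn_const
  refine Polynomial.eq_zero_of_infinite_isRoot P ((Icc_infinite zero_lt_one).mono fun t ht => ?_)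
  exact mul_self_eq_zero.1 (h3 ht)

/-- The inner product of polynomials in `L²` of the square. -/
noncomputable def polyInner : Poly →ₗ[ℝ] Poly →ₗ[ℝ] ℝ :=
  have hi : ∀ p q : Poly, Integrable (fun z => evalAt z p * evalAt z q) squareMeasure :=
    fun p q => integrable_square_of_continuousOn
      ((continuous_evalAt p).mul (continuous_evalAt q)).continuousOn
  LinearMap.mk₂ ℝ (fun p q => ∫ z, evalAt z p * evalAt z q ∂squareMeasure)
    (fun p p' q => by simp_rw [evalAt_add, add_mul]; exact integral_add (hi _ _) (hi _ _))
    (fun c p q => by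
      rw [smul_eq_mul, ← integral_const_mul]
      simp [evalAt, mul_assoc])
    (fun p q q' => by simp_rw [evalAt_add, mul_add]; exact integral_add (hi _ _) (hi _ _))
    (fun c p q => by
      rw [smul_eq_mul, ← integral_const_mul]
      simp [evalAt, mul_left_comm])

lemma polyInner_apply (p q : Poly) :
    polyInner p q = ∫ z, evalAt z p * evalAt z q ∂squareMeasure := rfl

lemma eq_zero_of_polyInner_self_eq_zero {q : Poly} (h : polyInner q q = 0) : q = 0 := by
  have h1 := eqOn_zero_of_integral_square_eq_zero
    ((continuous_evalAt q).mul (continuous_evalAt q)) (fun z _ => mul_self_nonneg _) h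
  refine eq_zero_of_evalAt_eq_zero fun x hx y hy => mul_self_eq_zero.1 (h1 (x, y) ?_)
  exact ⟨Ioo_subset_Icc_self hx, Ioo_subset_Icc_self hy⟩

/-- A bubble function times `r` is orthogonal to `r` only if `r = 0`. -/
lemma eq_zero_of_polyInner_bubble {i : Fin 2} {r : Poly}
    (h : polyInner (MvPolynomial.X i * ((MvPolynomial.X i - 1) * r)) r = 0) : r = 0 := by
  have e : ∀ z : ℝ × ℝ, evalAt z (MvPolynomial.X i * ((MvPolynomial.X i - 1) * r)) * evalAt z r =
      -(![z.1, z.2] i * (1 - ![z.1, z.2] i) * (evalAt z r * evalAt z r)) := by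
    intro z
    simp only [evalAt, map_mul, map_sub, MvPolynomial.eval_X, map_one]
    ring
  rw [polyInner_apply] at h
  simp_rw [e] at h
  rw [integral_neg, neg_eq_zero] at h
  have hc : Continuous fun z : ℝ × ℝ => ![z.1, z.2] i := by
    fin_cases i
    · exact continuous_fst
    · exact continuous_snd
  have hcr := continuous_evalAt r
  have hI : ∀ z ∈ refSquare, ![z.1, z.2] i ∈ Icc (0 : ℝ) 1 := by
    intro z hz
    fin_cases i
    · exact hz.1
    · exact hz.2
  have h1 := eqOn_zero_of_integral_square_eq_zero (by fun_prop) (fun z hz => by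
    have := hI z hz
    exact mul_nonneg (mul_nonneg this.1 (by linarith [this.2])) (mul_self_nonneg _)) h
  refine eq_zero_of_evalAt_eq_zero fun x hx y hy => ?_
  have h2 := h1 (x, y) ⟨Ioo_subset_Icc_self hx, Ioo_subset_Icc_self hy⟩
  have h3 : ![x, y] i ∈ Ioo (0 : ℝ) 1 := by
    fin_cases i
    · exact hx
    · exact hy
  have h4 : ![x, y] i * (1 - ![x, y] i) ≠ 0 := mul_ne_zero h3.1.ne' (by linarith [h3.2])
  exact mul_self_eq_zero.1 ((mul_eq_zero.1 h2).resolve_left h4)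

lemma integral_mul_eval_eq_zero {f : ℝ → ℝ} (hf : ContinuousOn f (Icc 0 1)) {k : ℕ}
    (h : ∀ i ≤ k, ∫ t in (0 : ℝ)..1, f t * t ^ i = 0) {q : Polynomial ℝ} (hq : q.natDegree ≤ k) :
    ∫ t in (0 : ℝ)..1, f t * q.eval t = 0 := by
  simp_rw [Polynomial.eval_eq_sum_range' (Nat.lt_succ_of_le hq), Finset.mul_sum]
  rw [intervalIntegral.integral_finsetSum]
  · refine Finset.sum_eq_zero fun i hi => ?_
    simp_rw [mul_left_comm (f _)]
    rw [intervalIntegral.integral_const_mul, h i (by simpa [Nat.lt_succ_iff] using hi), mul_zero]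
  · intro i _
    refine ContinuousOn.intervalIntegrable ?_
    rw [uIcc_of_le zero_le_one]
    fun_prop

/-! ### Unisolvence of the degrees of freedom -/

/-- The element of `BDM_k` given by two polynomials and the coefficients of the two curls. -/
noncomputable def bdmCombination (k : ℕ) : Poly × Poly × ℝ × ℝ →ₗ[ℝ] Poly × Poly where
  toFun e := (e.1, e.2.1) +
    (e.2.2.1 • curl (MvPolynomial.X 0 ^ (k + 1) * MvPolynomial.X 1) +
      e.2.2.2 • curl (MvPolynomial.X 0 * MvPolynomial.X 1 ^ (k + 1)))
  map_add' e e' := by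
    simp only [Prod.fst_add, Prod.snd_add, add_smul, ← Prod.mk_add_mk]
    abel
  map_smul' c e := by
    simp only [Prod.smul_fst, Prod.smul_snd, RingHom.id_apply, smul_add, smul_smul, smul_eq_mul,
      Prod.smul_mk]

lemma bdmCombination_fst (k : ℕ) (p q : Poly) (a b : ℝ) :
    (bdmCombination k (p, q, a, b)).1 = p + MvPolynomial.C a * MvPolynomial.X 0 ^ (k + 1) +
      MvPolynomial.C (b * (k + 1)) * (MvPolynomial.X 0 * MvPolynomial.X 1 ^ k) := by
  simp [bdmCombination, curl, MvPolynomial.pderiv_X_of_ne (show (0 : Fin 2) ≠ 1 by decide), MvPolynomial.smul_eq_C_mul]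
  ring

lemma bdmCombination_snd (k : ℕ) (p q : Poly) (a b : ℝ) :
    (bdmCombination k (p, q, a, b)).2 = q - MvPolynomial.C b * MvPolynomial.X 1 ^ (k + 1) -
      MvPolynomial.C (a * (k + 1)) * (MvPolynomial.X 1 * MvPolynomial.X 0 ^ k) := by
  simp [bdmCombination, curl, MvPolynomial.pderiv_X_of_ne (show (1 : Fin 2) ≠ 0 by decide), MvPolynomial.smul_eq_C_mul]
  ring

lemma mem_bdmSpace_iff {k : ℕ} {v : Poly × Poly} :
    v ∈ bdmSpace k ↔ ∃ p q : Poly, ∃ a b : ℝ, p.totalDegree ≤ k ∧ q.totalDegree ≤ k ∧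
      bdmCombination k (p, q, a, b) = v := by
  rw [bdmSpace, Submodule.mem_sup]
  constructor
  · rintro ⟨⟨p, q⟩, ⟨hp, hq⟩, c, hc, rfl⟩
    obtain ⟨a, b, rfl⟩ := Submodule.mem_span_pair.1 hc
    exact ⟨p, q, a, b, (MvPolynomial.mem_restrictTotalDegree _ _ _).1 hp,
      (MvPolynomial.mem_restrictTotalDegree _ _ _).1 hq, rfl⟩
  · rintro ⟨p, q, a, b, hp, hq, rfl⟩
    exact ⟨(p, q), ⟨(MvPolynomial.mem_restrictTotalDegree _ _ _).2 hp,
      (MvPolynomial.mem_restrictTotalDegree _ _ _).2 hq⟩, _,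
      Submodule.mem_span_pair.2 ⟨a, b, rfl⟩, rfl⟩

/-- The normal trace of a polynomial vector field on an edge. -/
noncomputable def normalTrace (v : Poly × Poly) (F : Edge) (t : ℝ) : ℝ :=
  dot (toField v (F.point t)) F.normal

lemma continuous_normalTrace (v : Poly × Poly) (F : Edge) : Continuous (normalTrace v F) := by
  have h1 := continuous_evalAt v.1
  have h2 := continuous_evalAt v.2
  unfold normalTrace
  cases F <;> simp only [dot, toField, Edge.point] <;> fun_prop

lemma exists_polynomial_evalAt {k : ℕ} {p : Poly} (hp : p.totalDegree ≤ k)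
    {f g : Polynomial ℝ} (hf : f.natDegree ≤ 1) (hg : g.natDegree ≤ 1) :
    ∃ P : Polynomial ℝ, P.natDegree ≤ k ∧ ∀ t, P.eval t = evalAt (f.eval t, g.eval t) p := by
  refine ⟨MvPolynomial.aeval ![f, g] p, ?_, fun t => ?_⟩
  · have := MvPolynomial.aeval_natDegree_le p hp ![f, g] (n := 1) (by
      intro i; fin_cases i <;> simpa)
    simpa using this
  · rw [evalAt, MvPolynomial.aeval_def, ← Polynomial.coe_evalRingHom, MvPolynomial.hom_eval₂,
      MvPolynomial.eval, MvPolynomial.coe_eval₂Hom]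
    congr 1
    · ext a
      simp
    · ext i
      fin_cases i <;> simp

/-- The normal traces of the elements of `BDM_k` are polynomials of degree at most `k`: the curls
contribute no term of degree `k + 1`. -/
lemma exists_polynomial_normalTrace {k : ℕ} {p q : Poly} (a b : ℝ) (hp : p.totalDegree ≤ k)
    (hq : q.totalDegree ≤ k) (F : Edge) :
    ∃ P : Polynomial ℝ, P.natDegree ≤ k ∧
      ∀ t, P.eval t = normalTrace (bdmCombination k (p, q, a, b)) F t := by
  have hX : (Polynomial.X : Polynomial ℝ).natDegree ≤ 1 := Polynomial.natDegree_X_le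
  have hC : ∀ c : ℝ, (Polynomial.C c).natDegree ≤ 1 := fun c => by simp
  have hdeg : ∀ (P : Polynomial ℝ) (c d : ℝ), P.natDegree ≤ k →
      (P + Polynomial.C c + Polynomial.C d * Polynomial.X ^ k).natDegree ≤ k := by
    intro P c d hP
    refine Polynomial.natDegree_add_le_of_degree_le
      (Polynomial.natDegree_add_le_of_degree_le hP (by simp)) ?_
    exact Polynomial.natDegree_C_mul_X_pow_le _ _
  cases F with
  | left =>
    obtain ⟨P, hP, hPe⟩ := exists_polynomial_evalAt hp (hC 0) hX
    refine ⟨-P, by rwa [Polynomial.natDegree_neg], fun t => ?_⟩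
    simp [normalTrace, dot, toField, Edge.point, Edge.normal, bdmCombination_fst, hPe]
    simp [evalAt]
  | right =>
    obtain ⟨P, hP, hPe⟩ := exists_polynomial_evalAt hp (hC 1) hX
    refine ⟨P + Polynomial.C a + Polynomial.C (b * (k + 1)) * Polynomial.X ^ k,
      hdeg _ _ _ hP, fun t => ?_⟩
    simp [normalTrace, dot, toField, Edge.point, Edge.normal, bdmCombination_fst, hPe]
    simp [evalAt]
  | bottom =>
    obtain ⟨P, hP, hPe⟩ := exists_polynomial_evalAt hq hX (hC 0)
    refine ⟨-P, by rwa [Polynomial.natDegree_neg], fun t => ?_⟩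
    simp [normalTrace, dot, toField, Edge.point, Edge.normal, bdmCombination_snd, hPe]
    simp [evalAt]
  | top =>
    obtain ⟨P, hP, hPe⟩ := exists_polynomial_evalAt hq hX (hC 1)
    refine ⟨P + Polynomial.C (-b) + Polynomial.C (-(a * (k + 1))) * Polynomial.X ^ k,
      hdeg _ _ _ hP, fun t => ?_⟩
    simp [normalTrace, dot, toField, Edge.point, Edge.normal, bdmCombination_snd, hPe]
    simp [evalAt]
    ring

/-- Unisolvence: an element of `BDM_k` whose degrees of freedom vanish is zero, with all its
coefficients. -/
theorem eq_zero_of_moments_eq_zero {k : ℕ} (hk : 1 ≤ k) {p q : Poly} {a b : ℝ}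
    (hp : p.totalDegree ≤ k) (hq : q.totalDegree ≤ k)
    (hE : ∀ (F : Edge) (i : ℕ), i ≤ k →
      ∫ t in (0 : ℝ)..1, normalTrace (bdmCombination k (p, q, a, b)) F t * t ^ i = 0)
    (h1 : ∀ r : Poly, r.totalDegree + 2 ≤ k → polyInner (bdmCombination k (p, q, a, b)).1 r = 0)
    (h2 : ∀ r : Poly, r.totalDegree + 2 ≤ k → polyInner (bdmCombination k (p, q, a, b)).2 r = 0) :
    p = 0 ∧ q = 0 ∧ a = 0 ∧ b = 0 := by
  have htr : ∀ F t, normalTrace (bdmCombination k (p, q, a, b)) F t = 0 := by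
    intro F t
    obtain ⟨P, hP, hPe⟩ := exists_polynomial_normalTrace a b hp hq F
    have h := integral_mul_eval_eq_zero (continuous_normalTrace _ F).continuousOn (hE F) hP
    simp_rw [← hPe] at h
    rw [← hPe, eq_zero_of_integral_mul_self_eq_zero h, Polynomial.eval_zero]
  have hz : ∀ x : Fin 2 → ℝ, ![x 0, x 1] = x := fun x => by ext i; fin_cases i <;> rfl
  have hx0 : ∀ x : Fin 2 → ℝ, x 0 = 0 →
      MvPolynomial.eval x (bdmCombination k (p, q, a, b)).1 = 0 := by
    intro x hx
    have := htr .left (x 1)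
    simp only [normalTrace, dot, toField, evalAt, Edge.point, Edge.normal] at this
    rw [← hz x, hx]
    linarith
  have hx1 : ∀ x : Fin 2 → ℝ, x 0 = 1 →
      MvPolynomial.eval x (bdmCombination k (p, q, a, b)).1 = 0 := by
    intro x hx
    have := htr .right (x 1)
    simp only [normalTrace, dot, toField, evalAt, Edge.point, Edge.normal] at this
    rw [← hz x, hx]
    linarith
  have hy0 : ∀ x : Fin 2 → ℝ, x 1 = 0 →
      MvPolynomial.eval x (bdmCombination k (p, q, a, b)).2 = 0 := by
    intro x hx
    have := htr .bottom (x 0)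
    simp only [normalTrace, dot, toField, evalAt, Edge.point, Edge.normal] at this
    rw [← hz x, hx]
    linarith
  have hy1 : ∀ x : Fin 2 → ℝ, x 1 = 1 →
      MvPolynomial.eval x (bdmCombination k (p, q, a, b)).2 = 0 := by
    intro x hx
    have := htr .top (x 0)
    simp only [normalTrace, dot, toField, evalAt, Edge.point, Edge.normal] at this
    rw [← hz x, hx]
    linarith
  have hmon : ∀ (i : Fin 2) (c : ℝ),
      (MvPolynomial.C c * MvPolynomial.X i ^ (k + 1) : Poly).totalDegree ≤ k + 1 := by
    intro i c
    refine (MvPolynomial.totalDegree_mul _ _).trans ?_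
    rw [MvPolynomial.totalDegree_C, MvPolynomial.totalDegree_X_pow, zero_add]
  have hmon2 : ∀ (i j : Fin 2) (c : ℝ), (MvPolynomial.C c *
      (MvPolynomial.X i * MvPolynomial.X j ^ k) : Poly).totalDegree ≤ k + 1 := by
    intro i j c
    refine (MvPolynomial.totalDegree_mul _ _).trans ?_
    rw [MvPolynomial.totalDegree_C, zero_add]
    refine (MvPolynomial.totalDegree_mul _ _).trans ?_
    rw [MvPolynomial.totalDegree_X_pow, MvPolynomial.totalDegree_X, add_comm]
  have hk1 : (k + 1 : ℝ) ≠ 0 := by positivity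
  have hcoef : ∀ (i j : Fin 2) (r : Poly) (c d : ℝ), i ≠ j → r.totalDegree ≤ k →
      (r + MvPolynomial.C c * MvPolynomial.X i ^ (k + 1) + MvPolynomial.C d *
        (MvPolynomial.X i * MvPolynomial.X j ^ k)).coeff
          (Finsupp.single i 1 + Finsupp.single j k) = d := by
    intro i j r c d hij hr
    have e1 : r.coeff (Finsupp.single i 1 + Finsupp.single j k) = 0 := by
      refine coeff_eq_zero_of_lt (hr.trans_lt ?_)
      fin_cases i <;> fin_cases j <;> simp at hij ⊢
    rw [MvPolynomial.coeff_add, MvPolynomial.coeff_add, e1, MvPolynomial.coeff_C_mul,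
      MvPolynomial.coeff_C_mul, MvPolynomial.coeff_X_pow, MvPolynomial.coeff_X_mul,
      MvPolynomial.coeff_X_pow, if_pos rfl, if_neg]
    · ring
    · intro h
      have := DFunLike.congr_fun h j
      simp [Ne.symm hij] at this
      omega
  have hb : b = 0 := by
    have h := coeff_X_mul_X_pow_eq_zero (show (0 : Fin 2) ≠ 1 by decide) (k := k) (by
      rw [bdmCombination_fst]
      refine (MvPolynomial.totalDegree_add _ _).trans (max_le ?_ (hmon2 _ _ _))
      exact (MvPolynomial.totalDegree_add _ _).trans (max_le (by omega) (hmon _ _))) hx0 hx1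
    rw [bdmCombination_fst, hcoef 0 1 p a _ (by decide) hp] at h
    exact (mul_eq_zero.1 h).resolve_right hk1
  have e2 : (bdmCombination k (p, q, a, b)).2 =
      q + MvPolynomial.C (-b) * MvPolynomial.X 1 ^ (k + 1) +
        MvPolynomial.C (-(a * (k + 1))) * (MvPolynomial.X 1 * MvPolynomial.X 0 ^ k) := by
    rw [bdmCombination_snd, map_neg, map_neg]
    ring
  have ha : a = 0 := by
    have h := coeff_X_mul_X_pow_eq_zero (show (1 : Fin 2) ≠ 0 by decide) (k := k) (by
      rw [e2]
      refine (MvPolynomial.totalDegree_add _ _).trans (max_le ?_ (hmon2 _ _ _))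
      exact (MvPolynomial.totalDegree_add _ _).trans (max_le (by omega) (hmon _ _))) hy0 hy1
    rw [e2, hcoef 1 0 q _ _ (by decide) hq] at h
    exact (mul_eq_zero.1 (neg_eq_zero.1 h)).resolve_right hk1
  subst ha hb
  have ep : (bdmCombination k (p, q, 0, 0)).1 = p := by simp [bdmCombination_fst]
  have eq : (bdmCombination k (p, q, 0, 0)).2 = q := by simp [bdmCombination_snd]
  rw [ep] at h1 hx0 hx1
  rw [eq] at h2 hy0 hy1
  have key : ∀ (i : Fin 2) (s : Poly), s.totalDegree ≤ k →
      (∀ x : Fin 2 → ℝ, x i = 0 → MvPolynomial.eval x s = 0) →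
      (∀ x : Fin 2 → ℝ, x i = 1 → MvPolynomial.eval x s = 0) →
      (∀ r : Poly, r.totalDegree + 2 ≤ k → polyInner s r = 0) → s = 0 := by
    intro i s hs h0 h1 hI
    obtain ⟨r, hr, hr'⟩ := exists_eq_X_mul_X_sub_one_mul h0 h1
    have : r = 0 := by
      rcases hr' with h | h
      · exact h
      · have := hI r (by omega)
        rw [hr] at this
        exact eq_zero_of_polyInner_bubble this
    rw [hr, this]
    simp
  exact ⟨key 0 p hp hx0 hx1 h1, key 1 q hq hy0 hy1 h2, rfl, rfl⟩

/-! ### Dimension count and existence of the interpolant -/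

/-- Polynomials of total degree less than `n`; for `n = 0` this is the zero space. -/
noncomputable def lowDegree (n : ℕ) : Submodule ℝ Poly :=
  MvPolynomial.restrictSupport ℝ {m | m 0 + m 1 < n}

lemma mem_lowDegree_iff {n : ℕ} {q : Poly} :
    q ∈ lowDegree n ↔ ∀ m, q.coeff m ≠ 0 → m 0 + m 1 < n := by
  rw [lowDegree, MvPolynomial.mem_restrictSupport_iff]
  exact ⟨fun h m hm => h (MvPolynomial.mem_support_iff.2 hm),
    fun h m hm => h m (MvPolynomial.mem_support_iff.1 hm)⟩

lemma mem_lowDegree_succ_iff {n : ℕ} {q : Poly} : q ∈ lowDegree (n + 1) ↔ q.totalDegree ≤ n := by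
  rw [← MvPolynomial.mem_restrictTotalDegree, MvPolynomial.restrictTotalDegree, lowDegree]
  have : {m : Fin 2 →₀ ℕ | m 0 + m 1 < n + 1} = {m | (m.sum fun _ e => e) ≤ n} := by
    ext m
    have := Finsupp.sum_fintype m (fun _ e => e) (fun _ => rfl)
    rw [Fin.sum_univ_two] at this
    rw [mem_ofPred_eq, mem_ofPred_eq, this, Nat.lt_succ_iff]
  rw [this]

lemma mem_lowDegree_pred {k : ℕ} {q : Poly} (h : q.totalDegree + 2 ≤ k) :
    q ∈ lowDegree (k - 1) := by
  obtain ⟨j, rfl⟩ := Nat.exists_eq_add_of_le' h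
  rw [show j + (q.totalDegree + 2) - 1 = (j + q.totalDegree) + 1 by omega, mem_lowDegree_succ_iff]
  omega

/-- The exponents of degree less than `n`, as pairs. -/
noncomputable def lowDegreeExponentEquiv (n : ℕ) :
    {m : Fin 2 →₀ ℕ | m 0 + m 1 < n} ≃
      ((Finset.range n).biUnion Finset.HasAntidiagonal.antidiagonal : Finset (ℕ × ℕ)) :=
  (Finsupp.equivFunOnFinite.trans (finTwoArrowEquiv ℕ)).subtypeEquiv fun m => by
    simp [Finset.HasAntidiagonal.mem_antidiagonal]

noncomputable instance (n : ℕ) : Fintype {m : Fin 2 →₀ ℕ | m 0 + m 1 < n} :=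
  Fintype.ofEquiv _ (lowDegreeExponentEquiv n).symm

/-- The monomial basis of the polynomials of degree less than `n`. -/
noncomputable def lowDegreeBasis (n : ℕ) :
    Module.Basis {m : Fin 2 →₀ ℕ | m 0 + m 1 < n} ℝ (lowDegree n) :=
  MvPolynomial.basisRestrictSupport ℝ _

instance (n : ℕ) : FiniteDimensional ℝ (lowDegree n) := .of_basis (lowDegreeBasis n)

lemma two_mul_finrank_lowDegree (n : ℕ) : 2 * Module.finrank ℝ (lowDegree n) = n * (n + 1) := by
  rw [Module.finrank_eq_card_basis (lowDegreeBasis n),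
    Fintype.card_congr (lowDegreeExponentEquiv n), Fintype.card_coe, Finset.card_biUnion]
  · simp only [Finset.Nat.card_antidiagonal]
    induction n with
    | zero => rfl
    | succ n ih =>
      rw [Finset.sum_range_succ, mul_add, ih]
      ring
  · intro i _ j _ hij
    rw [Function.onFun, Finset.disjoint_left]
    intro α h1 h2
    rw [Finset.HasAntidiagonal.mem_antidiagonal] at h1 h2
    exact hij (h1.symm.trans h2)

instance : Fintype Edge where
  elems := ⟨{.left, .right, .bottom, .top}, by simp⟩
  complete F := by cases F <;> simp

lemma card_edge : Fintype.card Edge = 4 := rfl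

/-- A moment of the normal trace on an edge. -/
noncomputable def edgeMoment (F : Edge) (i : ℕ) : Poly × Poly →ₗ[ℝ] ℝ where
  toFun v := ∫ t in (0 : ℝ)..1, normalTrace v F t * t ^ i
  map_add' v v' := by
    rw [← intervalIntegral.integral_add]
    · congr 1 with t
      simp only [normalTrace, dot, toField, Prod.fst_add, Prod.snd_add, evalAt_add]
      ring
    · exact ((continuous_normalTrace v F).mul (continuous_pow i)).intervalIntegrable _ _
    · exact ((continuous_normalTrace v' F).mul (continuous_pow i)).intervalIntegrable _ _
  map_smul' c v := by
    rw [RingHom.id_apply, smul_eq_mul, ← intervalIntegral.integral_const_mul]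
    congr 1 with t
    simp [normalTrace, dot, toField, evalAt]
    ring

/-- The degrees of freedom of `BDM_k`, in terms of the two polynomial components and the
coefficients of the two curls. -/
noncomputable def degreesOfFreedom (k : ℕ) :
    (lowDegree (k + 1) × lowDegree (k + 1) × ℝ × ℝ) →ₗ[ℝ]
      (Edge → Fin (k + 1) → ℝ) × Module.Dual ℝ (lowDegree (k - 1)) ×
        Module.Dual ℝ (lowDegree (k - 1)) :=
  let ι : (lowDegree (k + 1) × lowDegree (k + 1) × ℝ × ℝ) →ₗ[ℝ] Poly × Poly :=
    bdmCombination k ∘ₗ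
      (lowDegree (k + 1)).subtype.prodMap ((lowDegree (k + 1)).subtype.prodMap LinearMap.id)
  let ρ : Poly →ₗ[ℝ] Module.Dual ℝ (lowDegree (k - 1)) :=
    (lowDegree (k - 1)).subtype.dualMap ∘ₗ polyInner
  (LinearMap.pi fun F => LinearMap.pi fun i : Fin (k + 1) => edgeMoment F i ∘ₗ ι).prod
    ((ρ ∘ₗ LinearMap.fst ℝ Poly Poly ∘ₗ ι).prod (ρ ∘ₗ LinearMap.snd ℝ Poly Poly ∘ₗ ι))

lemma degreesOfFreedom_injective {k : ℕ} (hk : 1 ≤ k) :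
    Function.Injective (degreesOfFreedom k) := by
  rw [← LinearMap.ker_eq_bot, LinearMap.ker_eq_bot']
  rintro ⟨p, q, a, b⟩ h
  obtain ⟨h1, h2⟩ := Prod.mk.inj h
  obtain ⟨h2, h3⟩ := Prod.mk.inj h2
  have := eq_zero_of_moments_eq_zero hk (mem_lowDegree_succ_iff.1 p.2)
    (mem_lowDegree_succ_iff.1 q.2) (a := a) (b := b)
    (fun F i hi => congrFun (congrFun h1 F) ⟨i, Nat.lt_succ_of_le hi⟩)
    (fun r hr => LinearMap.congr_fun h2 ⟨r, mem_lowDegree_pred hr⟩)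
    (fun r hr => LinearMap.congr_fun h3 ⟨r, mem_lowDegree_pred hr⟩)
  obtain ⟨hp, hq, rfl, rfl⟩ := this
  rw [Submodule.coe_eq_zero] at hp hq
  rw [hp, hq]
  rfl

lemma degreesOfFreedom_surjective {k : ℕ} (hk : 1 ≤ k) :
    Function.Surjective (degreesOfFreedom k) := by
  refine (LinearMap.injective_iff_surjective_of_finrank_eq_finrank ?_).1
    (degreesOfFreedom_injective hk)
  -- the count is `(k + 1) (k + 2) + 2 = 4 (k + 1) + (k - 1) k`
  simp only [Module.finrank_prod, Module.finrank_self, Module.finrank_pi_fintype,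
    Subspace.dual_finrank_eq, Finset.sum_const, Finset.card_univ, card_edge, Fintype.card_fin,
    smul_eq_mul, mul_one]
  have h1 := two_mul_finrank_lowDegree (k + 1)
  have h2 := two_mul_finrank_lowDegree (k - 1)
  obtain ⟨j, rfl⟩ := Nat.exists_eq_add_of_le' hk
  rw [Nat.add_sub_cancel] at h2 ⊢
  nlinarith

lemma continuousOn_comp_point {u : ℝ × ℝ → ℝ × ℝ} (hu : ContinuousOn u refSquare) (F : Edge) :
    ContinuousOn (fun t => dot (u (F.point t)) F.normal) (Icc 0 1) := by
  have hF : Continuous F.point := by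
    cases F
    exacts [continuous_const.prodMk continuous_id, continuous_const.prodMk continuous_id,
      continuous_id.prodMk continuous_const, continuous_id.prodMk continuous_const]
  have hm : MapsTo F.point (Icc 0 1) refSquare := by
    intro t ht
    cases F <;> simpa [refSquare, Edge.point] using ht
  have h := hu.comp hF.continuousOn hm
  exact (h.fst.mul continuousOn_const).add (h.snd.mul continuousOn_const)

lemma integrable_fst_mul_evalAt {u : ℝ × ℝ → ℝ × ℝ} (hu : ContinuousOn u refSquare) (q : Poly) :
    Integrable (fun z => (u z).1 * evalAt z q) squareMeasure :=
  integrable_square_of_continuousOn (hu.fst.mul (continuous_evalAt q).continuousOn)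

lemma integrable_snd_mul_evalAt {u : ℝ × ℝ → ℝ × ℝ} (hu : ContinuousOn u refSquare) (q : Poly) :
    Integrable (fun z => (u z).2 * evalAt z q) squareMeasure :=
  integrable_square_of_continuousOn (hu.snd.mul (continuous_evalAt q).continuousOn)

/-- The interpolation conditions in terms of monomials on the edges and of the two components
on the square. -/
lemma isBDMInterpolant_iff {k : ℕ} {u : ℝ × ℝ → ℝ × ℝ} (hu : ContinuousOn u refSquare)
    {v : Poly × Poly} :
    IsBDMInterpolant k u v ↔ v ∈ bdmSpace k ∧
      (∀ (F : Edge) (i : ℕ), i ≤ k → ∫ t in (0 : ℝ)..1, normalTrace v F t * t ^ i =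
        ∫ t in (0 : ℝ)..1, dot (u (F.point t)) F.normal * t ^ i) ∧
      (∀ r : Poly, r.totalDegree + 2 ≤ k →
        polyInner v.1 r = ∫ z, (u z).1 * evalAt z r ∂squareMeasure) ∧
      (∀ r : Poly, r.totalDegree + 2 ≤ k →
        polyInner v.2 r = ∫ z, (u z).2 * evalAt z r ∂squareMeasure) := by
  have hsub : ∀ F t, dot (toField v (F.point t) - u (F.point t)) F.normal =
      normalTrace v F t - dot (u (F.point t)) F.normal := by
    intro F t
    simp only [normalTrace, dot, Prod.fst_sub, Prod.snd_sub]
    ring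
  have hc := fun F => continuousOn_comp_point hu F
  have hn := fun F => (continuous_normalTrace v F).continuousOn (s := Icc (0 : ℝ) 1)
  have hedge : ∀ (F : Edge) (i : ℕ),
      ∫ t in (0 : ℝ)..1, dot (toField v (F.point t) - u (F.point t)) F.normal * t ^ i =
      (∫ t in (0 : ℝ)..1, normalTrace v F t * t ^ i) -
        ∫ t in (0 : ℝ)..1, dot (u (F.point t)) F.normal * t ^ i := by
    intro F i
    simp_rw [hsub, sub_mul]
    refine intervalIntegral.integral_sub ?_ ?_
    all_goals
      refine ContinuousOn.intervalIntegrable ?_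
      rw [uIcc_of_le zero_le_one]
    · exact (hn F).mul (continuousOn_pow i)
    · exact (hc F).mul (continuousOn_pow i)
  have hint : ∀ q : Poly × Poly,
      ∫ z, dot (toField v z - u z) (toField q z) ∂squareMeasure =
      (polyInner v.1 q.1 - ∫ z, (u z).1 * evalAt z q.1 ∂squareMeasure) +
        (polyInner v.2 q.2 - ∫ z, (u z).2 * evalAt z q.2 ∂squareMeasure) := by
    intro q
    have hi : ∀ p q : Poly, Integrable (fun z => evalAt z p * evalAt z q) squareMeasure :=
      fun p q => integrable_square_of_continuousOn
        ((continuous_evalAt p).mul (continuous_evalAt q)).continuousOn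
    rw [polyInner_apply, polyInner_apply, ← integral_sub (hi _ _) (integrable_fst_mul_evalAt hu _),
      ← integral_sub (hi _ _) (integrable_snd_mul_evalAt hu _), ← integral_add]
    · congr 1 with z
      simp only [dot, toField, Prod.fst_sub, Prod.snd_sub]
      ring
    · exact (hi _ _).sub (integrable_fst_mul_evalAt hu _)
    · exact (hi _ _).sub (integrable_snd_mul_evalAt hu _)
  refine and_congr_right fun _ => ⟨fun h => ⟨fun F i hi => ?_, fun r hr => ?_, fun r hr => ?_⟩,
    fun h => ⟨fun F q hq => ?_, fun q hq1 hq2 => ?_⟩⟩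
  · have := h.1 F (Polynomial.X ^ i) ((Polynomial.natDegree_X_pow i).trans_le hi)
    simp only [Polynomial.eval_pow, Polynomial.eval_X] at this
    rw [hedge] at this
    linarith
  · have := h.2 (r, 0) hr (by rw [MvPolynomial.totalDegree_zero]; omega)
    rw [hint] at this
    simp only [map_zero, evalAt, mul_zero, integral_zero, sub_zero, add_zero] at this
    exact sub_eq_zero.1 this
  · have := h.2 (0, r) (by rw [MvPolynomial.totalDegree_zero]; omega) hr
    rw [hint] at this
    simp only [map_zero, evalAt, mul_zero, integral_zero, sub_zero, zero_add] at this
    exact sub_eq_zero.1 this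
  · refine integral_mul_eval_eq_zero ?_ (fun i hi => ?_) hq
    · simp_rw [hsub]
      exact (hn F).sub (hc F)
    · rw [hedge, h.1 F i hi, sub_self]
  · rw [hint, h.2.1 _ hq1, h.2.2 _ hq2, sub_self, sub_self, add_zero]

/-- Integration against an integrable function, as a functional on polynomials of low degree. -/
noncomputable def integralFunctional (n : ℕ) {f : ℝ × ℝ → ℝ}
    (hf : ∀ q : Poly, Integrable (fun z => f z * evalAt z q) squareMeasure) :
    Module.Dual ℝ (lowDegree n) where
  toFun q := ∫ z, f z * evalAt z q ∂squareMeasure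
  map_add' q q' := by
    rw [← integral_add (hf _) (hf _)]
    simp only [Submodule.coe_add, evalAt_add, mul_add]
  map_smul' c q := by
    rw [RingHom.id_apply, smul_eq_mul, ← integral_const_mul]
    simp [evalAt, mul_left_comm]

theorem existsUnique_isBDMInterpolant {k : ℕ} (hk : 1 ≤ k) {u : ℝ × ℝ → ℝ × ℝ}
    (hu : ContinuousOn u refSquare) : ∃! v : Poly × Poly, IsBDMInterpolant k u v := by
  obtain ⟨⟨p, q, a, b⟩, he⟩ := degreesOfFreedom_surjective hk
    (fun F i => ∫ t in (0 : ℝ)..1, dot (u (F.point t)) F.normal * t ^ (i : ℕ),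
      integralFunctional (k - 1) (integrable_fst_mul_evalAt hu),
      integralFunctional (k - 1) (integrable_snd_mul_evalAt hu))
  obtain ⟨h1, h2⟩ := Prod.mk.inj he
  obtain ⟨h2, h3⟩ := Prod.mk.inj h2
  have hp := mem_lowDegree_succ_iff.1 p.2
  have hq := mem_lowDegree_succ_iff.1 q.2
  refine ⟨bdmCombination k (p, q, a, b), (isBDMInterpolant_iff hu).2
    ⟨mem_bdmSpace_iff.2 ⟨p, q, a, b, hp, hq, rfl⟩,
      fun F i hi => congrFun (congrFun h1 F) ⟨i, Nat.lt_succ_of_le hi⟩,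
      fun r hr => LinearMap.congr_fun h2 ⟨r, mem_lowDegree_pred hr⟩,
      fun r hr => LinearMap.congr_fun h3 ⟨r, mem_lowDegree_pred hr⟩⟩, fun v hv => ?_⟩
  obtain ⟨hv, hv1, hv2, hv3⟩ := (isBDMInterpolant_iff hu).1 hv
  obtain ⟨p', q', a', b', hp', hq', rfl⟩ := mem_bdmSpace_iff.1 hv
  have hsub : bdmCombination k (p' - p, q' - q, a' - a, b' - b) =
      bdmCombination k (p', q', a', b') - bdmCombination k (p, q, a, b) := by
    rw [← map_sub]
    rfl
  have := eq_zero_of_moments_eq_zero hk (p := p' - p) (q := q' - q) (a := a' - a) (b := b' - b)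
    ((MvPolynomial.totalDegree_sub _ _).trans (max_le hp' hp))
    ((MvPolynomial.totalDegree_sub _ _).trans (max_le hq' hq))
    (fun F i hi => by
      have e1 := hv1 F i hi
      have e2 : edgeMoment F i (bdmCombination k (p, q, a, b)) = _ :=
        congrFun (congrFun h1 F) ⟨i, Nat.lt_succ_of_le hi⟩
      change edgeMoment F i _ = 0
      rw [hsub, map_sub, e2, sub_eq_zero]
      exact e1)
    (fun r hr => by
      have e2 : polyInner (bdmCombination k (p, q, a, b)).1 r = _ :=
        LinearMap.congr_fun h2 ⟨r, mem_lowDegree_pred hr⟩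
      rw [hsub, Prod.fst_sub, map_sub, LinearMap.sub_apply, hv2 r hr, e2]
      exact sub_self _)
    (fun r hr => by
      have e2 : polyInner (bdmCombination k (p, q, a, b)).2 r = _ :=
        LinearMap.congr_fun h3 ⟨r, mem_lowDegree_pred hr⟩
      rw [hsub, Prod.snd_sub, map_sub, LinearMap.sub_apply, hv3 r hr, e2]
      exact sub_self _)
  rw [sub_eq_zero.1 this.1, sub_eq_zero.1 this.2.1, sub_eq_zero.1 this.2.2.1,
    sub_eq_zero.1 this.2.2.2]

/-! ### The divergence of the interpolant as an orthogonal projection -/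

lemma exists_continuous_eqOn_refSquare {f : ℝ × ℝ → ℝ} (hf : ContinuousOn f refSquare) :
    ∃ g : ℝ × ℝ → ℝ, Continuous g ∧ EqOn g f refSquare := by
  have hc : Continuous fun z : ℝ × ℝ => (max 0 (min z.1 1), max 0 (min z.2 1)) := by fun_prop
  refine ⟨fun z => f (max 0 (min z.1 1), max 0 (min z.2 1)), hf.comp_continuous hc fun z => ?_,
    fun z hz => ?_⟩
  · exact ⟨⟨le_max_left _ _, max_le zero_le_one (min_le_right _ _)⟩,
      ⟨le_max_left _ _, max_le zero_le_one (min_le_right _ _)⟩⟩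
  · simp only
    rw [min_eq_left hz.1.2, min_eq_left hz.2.2, max_eq_right hz.1.1, max_eq_right hz.2.1]

lemma ae_mem_refSquare : ∀ᵐ z ∂squareMeasure, z ∈ refSquare :=
  ae_restrict_mem (measurableSet_Icc.prod measurableSet_Icc)

lemma continuous_partialX (φ : 𝓓(openSquare, ℝ)) : Continuous (partialX φ) :=
  (φ.contDiff.continuous_fderiv (by simp)).clm_apply continuous_const

lemma continuous_partialY (φ : 𝓓(openSquare, ℝ)) : Continuous (partialY φ) :=
  (φ.contDiff.continuous_fderiv (by simp)).clm_apply continuous_const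

/-- Polynomials can be integrated by parts against test functions. -/
lemma integral_evalAt_mul_fderiv (q : Poly) (φ : 𝓓(openSquare, ℝ)) (e : ℝ × ℝ) :
    ∫ z, evalAt z q * fderiv ℝ φ z e ∂squareMeasure =
      -∫ z, fderiv ℝ (fun z => evalAt z q) z e * φ z ∂squareMeasure := by
  have hφ : HasCompactSupport φ := φ.hasCompactSupport
  have hdφ : HasCompactSupport fun z => fderiv ℝ φ z e := hφ.fderiv_apply ℝ e
  have hcdφ : Continuous fun z => fderiv ℝ φ z e :=
    (φ.contDiff.continuous_fderiv (by simp)).clm_apply continuous_const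
  have hcq := continuous_evalAt q
  have hcdq : Continuous fun z => fderiv ℝ (fun z => evalAt z q) z e := by
    have h0 := continuous_evalAt (MvPolynomial.pderiv 0 q)
    have h1 := continuous_evalAt (MvPolynomial.pderiv 1 q)
    have : (fun z => fderiv ℝ (fun z => evalAt z q) z e) = fun z =>
        evalAt z (MvPolynomial.pderiv 0 q) * e.1 + evalAt z (MvPolynomial.pderiv 1 q) * e.2 := by
      ext z
      simp [(hasFDerivAt_evalAt q z).fderiv]
    rw [this]
    fun_prop
  have key := integral_mul_fderiv_eq_neg_fderiv_mul_of_integrable (μ := (volume : Measure (ℝ × ℝ)))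
    (f := fun z => evalAt z q) (g := φ) (v := e)
    ((hcdq.mul φ.continuous).integrable_of_hasCompactSupport hφ.mul_left)
    ((hcq.mul hcdφ).integrable_of_hasCompactSupport hdφ.mul_left)
    ((hcq.mul φ.continuous).integrable_of_hasCompactSupport hφ.mul_left)
    (fun z _ => (hasFDerivAt_evalAt q z).differentiableAt)
    (fun z _ => (φ.contDiff.differentiable (by simp)).differentiableAt)
  rw [squareMeasure_eq_restrict_openSquare]
  rw [setIntegral_eq_integral_of_forall_compl_eq_zero, key,
    setIntegral_eq_integral_of_forall_compl_eq_zero]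
  · intro z hz
    rw [image_eq_zero_of_notMem_tsupport fun h => hz (φ.tsupport_subset h), mul_zero]
  · intro z hz
    have : fderiv ℝ φ z = 0 := by
      by_contra h
      exact hz (φ.tsupport_subset (support_fderiv_subset ℝ h))
    rw [this]
    simp

lemma continuous_toField (v : Poly × Poly) : Continuous (toField v) :=
  (continuous_evalAt v.1).prodMk (continuous_evalAt v.2)

lemma HasWeakDiv.sub_toField {u : ℝ × ℝ → ℝ × ℝ} {w : ℝ × ℝ → ℝ} (h : HasWeakDiv u w)
    (hu : ContinuousOn u refSquare) (hw : Integrable w squareMeasure) (v : Poly × Poly) :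
    HasWeakDiv (fun z => u z - toField v z) (fun z => w z - evalAt z (divPoly v)) := by
  have hv1 := continuous_evalAt v.1
  have hv2 := continuous_evalAt v.2
  have hm : MeasurableSet (openSquare : Set (ℝ × ℝ)) := openSquare.isOpen.measurableSet
  refine ⟨h.1.sub ((continuous_toField v).continuousOn.locallyIntegrableOn hm),
    h.2.1.sub ((continuous_evalAt _).continuousOn.locallyIntegrableOn hm), fun φ => ?_⟩
  have hX := continuous_partialX φ
  have hY := continuous_partialY φ
  have hφ := φ.continuous
  have hpoly : ∫ z, (evalAt z v.1 * partialX φ z + evalAt z v.2 * partialY φ z) ∂squareMeasure =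
      -∫ z, evalAt z (divPoly v) * φ z ∂squareMeasure := by
    have h0 := continuous_evalAt (MvPolynomial.pderiv 0 v.1)
    have h1 := continuous_evalAt (MvPolynomial.pderiv 1 v.2)
    have e1 := integral_evalAt_mul_fderiv v.1 φ (1, 0)
    have e2 := integral_evalAt_mul_fderiv v.2 φ (0, 1)
    have e3 : ∀ z, fderiv ℝ (fun z => evalAt z v.1) z (1, 0) =
        evalAt z (MvPolynomial.pderiv 0 v.1) := fun z => congrFun (partialX_evalAt v.1) z
    have e4 : ∀ z, fderiv ℝ (fun z => evalAt z v.2) z (0, 1) =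
        evalAt z (MvPolynomial.pderiv 1 v.2) := fun z => congrFun (partialY_evalAt v.2) z
    simp only [e3] at e1
    simp only [e4] at e2
    simp only [divPoly, evalAt_add, add_mul]
    rw [integral_add, integral_add, neg_add, ← e1, ← e2]
    · rfl
    all_goals exact integrable_square_of_continuousOn (by fun_prop)
  have e1 : ∫ z, ((u z - toField v z).1 * partialX φ z + (u z - toField v z).2 * partialY φ z)
      ∂squareMeasure = (∫ z, ((u z).1 * partialX φ z + (u z).2 * partialY φ z) ∂squareMeasure) -
      ∫ z, (evalAt z v.1 * partialX φ z + evalAt z v.2 * partialY φ z) ∂squareMeasure := by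
    rw [← integral_sub]
    · congr 1 with z
      simp only [toField, Prod.fst_sub, Prod.snd_sub]
      ring
    · exact integrable_square_of_continuousOn
        ((hu.fst.mul hX.continuousOn).add (hu.snd.mul hY.continuousOn))
    · exact integrable_square_of_continuousOn (by fun_prop)
  rw [e1, hpoly, h.2.2 φ]
  have hdφ : Integrable (fun z => evalAt z (divPoly v) * φ z) squareMeasure :=
    integrable_square_of_continuousOn ((continuous_evalAt _).mul hφ).continuousOn
  simp_rw [sub_mul]
  rw [integral_sub (integrable_mul_continuous hw hφ) hdφ]
  ring

lemma evalAt_X_pow_mul_X_pow (z : ℝ × ℝ) (c : ℝ) (i j : ℕ) :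
    evalAt z (MvPolynomial.C c * (MvPolynomial.X 0 ^ i * MvPolynomial.X 1 ^ j)) =
      c * (z.1 ^ i * z.2 ^ j) := by
  simp [evalAt]

lemma totalDegree_C_mul_X_pow_mul_X_pow_le (c : ℝ) (i j : ℕ) :
    (MvPolynomial.C c * (MvPolynomial.X 0 ^ i * MvPolynomial.X 1 ^ j) : Poly).totalDegree ≤
      i + j := by
  refine (MvPolynomial.totalDegree_mul _ _).trans ?_
  rw [MvPolynomial.totalDegree_C, zero_add]
  refine (MvPolynomial.totalDegree_mul _ _).trans ?_
  rw [MvPolynomial.totalDegree_X_pow, MvPolynomial.totalDegree_X_pow]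

/-- If the degrees of freedom of a continuous vector field with integrable weak divergence vanish,
then its divergence is orthogonal to the polynomials of degree less than `k`: the gradients of
these are admissible test functions on the square, and their traces are admissible on the edges. -/
lemma HasWeakDiv.integral_mul_monomial_eq_zero {k : ℕ} {u : ℝ × ℝ → ℝ × ℝ} {g : ℝ × ℝ → ℝ}
    (h : HasWeakDiv u g) (hu : ContinuousOn u refSquare) (hg : Integrable g squareMeasure)
    (hE : ∀ (F : Edge) (i : ℕ), i ≤ k →
      ∫ t in (0 : ℝ)..1, dot (u (F.point t)) F.normal * t ^ i = 0)
    (h1 : ∀ r : Poly, r.totalDegree + 2 ≤ k → ∫ z, (u z).1 * evalAt z r ∂squareMeasure = 0)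
    (h2 : ∀ r : Poly, r.totalDegree + 2 ≤ k → ∫ z, (u z).2 * evalAt z r ∂squareMeasure = 0)
    {i j : ℕ} (hij : i + j < k) :
    ∫ z, g z * (z.1 ^ i * z.2 ^ j) ∂squareMeasure = 0 := by
  obtain ⟨a, ha, hau⟩ := exists_continuous_eqOn_refSquare hu.fst
  obtain ⟨b, hb, hbu⟩ := exists_continuous_eqOn_refSquare hu.snd
  have hai := integrable_square_of_continuousOn ha.continuousOn
  have hbi := integrable_square_of_continuousOn hb.continuousOn
  have hae : ∀ᵐ z ∂squareMeasure, a z = (u z).1 := ae_mem_refSquare.mono fun z hz => hau hz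
  have hbe : ∀ᵐ z ∂squareMeasure, b z = (u z).2 := ae_mem_refSquare.mono fun z hz => hbu hz
  -- the interior moments
  have hz1 : ∀ m n : ℕ, m + n + 2 ≤ k → ∀ c : ℝ,
      ∫ z, a z * (c * (z.1 ^ m * z.2 ^ n)) ∂squareMeasure = 0 := by
    intro m n hmn c
    rw [← h1 (MvPolynomial.C c * (MvPolynomial.X 0 ^ m * MvPolynomial.X 1 ^ n))
      (by have := totalDegree_C_mul_X_pow_mul_X_pow_le c m n; omega)]
    refine integral_congr_ae (hae.mono fun z hz => ?_)
    simp only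
    rw [hz, evalAt_X_pow_mul_X_pow]
  have hz2 : ∀ m n : ℕ, m + n + 2 ≤ k → ∀ c : ℝ,
      ∫ z, b z * (c * (z.1 ^ m * z.2 ^ n)) ∂squareMeasure = 0 := by
    intro m n hmn c
    rw [← h2 (MvPolynomial.C c * (MvPolynomial.X 0 ^ m * MvPolynomial.X 1 ^ n))
      (by have := totalDegree_C_mul_X_pow_mul_X_pow_le c m n; omega)]
    refine integral_congr_ae (hbe.mono fun z hz => ?_)
    simp only
    rw [hz, evalAt_X_pow_mul_X_pow]
  -- the edge moments
  have hleft : ∀ n ≤ k, ∫ t in (0 : ℝ)..1, a (0, t) * t ^ n = 0 := by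
    intro n hn
    rw [← neg_eq_zero, ← intervalIntegral.integral_neg]
    refine (intervalIntegral.integral_congr ?_).trans (hE .left n hn)
    intro t ht
    rw [uIcc_of_le zero_le_one] at ht
    simp only [Edge.point, Edge.normal, dot, hau (x := (0, t)) ⟨⟨le_rfl, zero_le_one⟩, ht⟩]
    ring
  have hright : ∀ n ≤ k, ∫ t in (0 : ℝ)..1, a (1, t) * t ^ n = 0 := by
    intro n hn
    refine (intervalIntegral.integral_congr ?_).trans (hE .right n hn)
    intro t ht
    rw [uIcc_of_le zero_le_one] at ht
    simp only [Edge.point, Edge.normal, dot, hau (x := (1, t)) ⟨⟨zero_le_one, le_rfl⟩, ht⟩]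
    ring
  have hbottom : ∀ n ≤ k, ∫ t in (0 : ℝ)..1, b (t, 0) * t ^ n = 0 := by
    intro n hn
    rw [← neg_eq_zero, ← intervalIntegral.integral_neg]
    refine (intervalIntegral.integral_congr ?_).trans (hE .bottom n hn)
    intro t ht
    rw [uIcc_of_le zero_le_one] at ht
    simp only [Edge.point, Edge.normal, dot, hbu (x := (t, 0)) ⟨ht, ⟨le_rfl, zero_le_one⟩⟩]
    ring
  have htop : ∀ n ≤ k, ∫ t in (0 : ℝ)..1, b (t, 1) * t ^ n = 0 := by
    intro n hn
    refine (intervalIntegral.integral_congr ?_).trans (hE .top n hn)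
    intro t ht
    rw [uIcc_of_le zero_le_one] at ht
    simp only [Edge.point, Edge.normal, dot, hbu (x := (t, 1)) ⟨ht, ⟨zero_le_one, le_rfl⟩⟩]
    ring
  have hgreen := green_formula ha hb hg (fun ψ η hψ hη => by
    have e := h.2.2 (tensorTest hψ hη)
    rw [coe_tensorTest, partialX_mul_prod hψ.differentiable hη.differentiable,
      partialY_mul_prod hψ.differentiable hη.differentiable] at e
    have hψc := hψ.continuous
    have hψc' := hψ.deriv.continuous
    have hηc := hη.continuous
    have hηc' := hη.deriv.continuous
    rw [integral_add, ← neg_neg (∫ z, g z * (ψ z.1 * η z.2) ∂squareMeasure), ← e,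
      ← sub_eq_add_neg, sub_eq_zero]
    · refine integral_congr_ae ?_
      filter_upwards [hae, hbe] with z hz1 hz2
      rw [hz1, hz2]
    · exact integrable_square_of_continuousOn (by fun_prop)
    · exact integrable_mul_continuous hg (by fun_prop))
    (ψ := fun x => x ^ i) (η := fun y => y ^ j) (contDiff_id.pow i) (contDiff_id.pow j)
  have hbdry1 : ∫ y, (a (1, y) * 1 ^ i - a (0, y) * 0 ^ i) * y ^ j ∂unitMeasure = 0 := by
    have e : ∀ y : ℝ, (a (1, y) * 1 ^ i - a (0, y) * 0 ^ i) * y ^ j =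
        a (1, y) * y ^ j - 0 ^ i * (a (0, y) * y ^ j) := by
      intro y
      rw [one_pow]
      ring
    simp_rw [e]
    rw [integral_unitMeasure, intervalIntegral.integral_sub, intervalIntegral.integral_const_mul,
      hright j (by omega), hleft j (by omega)]
    · simp
    · exact Continuous.intervalIntegrable (by fun_prop) _ _
    · exact Continuous.intervalIntegrable (by fun_prop) _ _
  have hbdry2 : ∀ c : ℝ, c = 0 ∨ c = 1 → ∫ x, b (x, c) * x ^ i ∂unitMeasure = 0 := by
    rintro c (rfl | rfl)
    · rw [integral_unitMeasure]
      exact hbottom i (by omega)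
    · rw [integral_unitMeasure]
      exact htop i (by omega)
  rw [hbdry1, hbdry2 1 (Or.inr rfl), hbdry2 0 (Or.inl rfl), zero_mul, zero_mul, sub_zero,
    add_zero] at hgreen
  simp only [deriv_pow_field] at hgreen
  rw [integral_add, integral_add] at hgreen
  · have e1 : ∫ z, a z * (↑i * z.1 ^ (i - 1) * z.2 ^ j) ∂squareMeasure = 0 := by
      rcases Nat.eq_zero_or_pos i with rfl | hi
      · simp
      · simp_rw [mul_assoc (i : ℝ)]
        exact hz1 (i - 1) j (by omega) i
    have e2 : ∫ z, b z * (z.1 ^ i * (↑j * z.2 ^ (j - 1))) ∂squareMeasure = 0 := by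
      rcases Nat.eq_zero_or_pos j with rfl | hj
      · simp
      · have e : ∀ z : ℝ × ℝ, z.1 ^ i * (↑j * z.2 ^ (j - 1)) = ↑j * (z.1 ^ i * z.2 ^ (j - 1)) :=
          fun z => mul_left_comm _ _ _
        simp_rw [e]
        exact hz2 i (j - 1) (by omega) j
    rw [e1, e2, zero_add, zero_add] at hgreen
    exact hgreen
  · exact integrable_mul_continuous hai (by fun_prop)
  · exact integrable_mul_continuous hbi (by fun_prop)
  · exact (integrable_mul_continuous hai (by fun_prop)).add
      (integrable_mul_continuous hbi (by fun_prop))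
  · exact integrable_mul_continuous hg (by fun_prop)

lemma integral_mul_evalAt_eq_zero {k : ℕ} {g : ℝ × ℝ → ℝ} (hg : Integrable g squareMeasure)
    (h : ∀ i j : ℕ, i + j < k → ∫ z, g z * (z.1 ^ i * z.2 ^ j) ∂squareMeasure = 0)
    {q : Poly} (hq : q ∈ lowDegree k) : ∫ z, g z * evalAt z q ∂squareMeasure = 0 := by
  have e : ∀ z, g z * evalAt z q =
      ∑ m ∈ q.support, q.coeff m * (g z * (z.1 ^ m 0 * z.2 ^ m 1)) := by
    intro z
    rw [evalAt, MvPolynomial.eval_eq', Finset.mul_sum]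
    refine Finset.sum_congr rfl fun m _ => ?_
    rw [Fin.prod_univ_two]
    simp only [Matrix.cons_val_zero, Matrix.cons_val_one]
    ring
  simp_rw [e]
  rw [integral_finsetSum]
  · refine Finset.sum_eq_zero fun m hm => ?_
    rw [integral_const_mul, h _ _ (mem_lowDegree_iff.1 hq m (MvPolynomial.mem_support_iff.1 hm)),
      mul_zero]
  · intro m _
    exact (integrable_mul_continuous hg (by fun_prop)).const_mul _

/-- The divergence of the interpolation error is orthogonal to the polynomials of degree less
than `k`. -/
lemma IsBDMInterpolant.integral_div_mul_eq_zero {k : ℕ} {u : ℝ × ℝ → ℝ × ℝ} {w : ℝ × ℝ → ℝ}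
    {v : Poly × Poly} (hv : IsBDMInterpolant k u v) (hu : ContinuousOn u refSquare)
    (hw : Integrable w squareMeasure) (hdiv : HasWeakDiv u w) {q : Poly} (hq : q ∈ lowDegree k) :
    ∫ z, (w z - evalAt z (divPoly v)) * evalAt z q ∂squareMeasure = 0 := by
  obtain ⟨-, hE, h1, h2⟩ := (isBDMInterpolant_iff hu).1 hv
  have hg : Integrable (fun z => w z - evalAt z (divPoly v)) squareMeasure :=
    hw.sub ((memLp_evalAt _ 1).integrable le_rfl)
  refine integral_mul_evalAt_eq_zero hg (fun i j hij => ?_) hq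
  refine (hdiv.sub_toField hu hw v).integral_mul_monomial_eq_zero (k := k)
    (hu.sub (continuous_toField v).continuousOn) hg (fun F i hi => ?_) (fun r hr => ?_)
    (fun r hr => ?_) hij
  · have hc := continuousOn_comp_point hu F
    have hn := (continuous_normalTrace v F).continuousOn (s := Icc (0 : ℝ) 1)
    have e : ∀ t, dot (u (F.point t) - toField v (F.point t)) F.normal * t ^ i =
        dot (u (F.point t)) F.normal * t ^ i - normalTrace v F t * t ^ i := by
      intro t
      simp only [normalTrace, dot, Prod.fst_sub, Prod.snd_sub]
      ring
    simp_rw [e]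
    rw [intervalIntegral.integral_sub, hE F i hi, sub_self]
    all_goals
      refine ContinuousOn.intervalIntegrable ?_
      rw [uIcc_of_le zero_le_one]
    · exact hc.mul (continuousOn_pow i)
    · exact hn.mul (continuousOn_pow i)
  · simp only [Prod.fst_sub, sub_mul]
    rw [integral_sub (integrable_fst_mul_evalAt hu r)
      (integrable_fst_mul_evalAt (continuous_toField v).continuousOn r), ← h1 r hr]
    exact sub_self _
  · simp only [Prod.snd_sub, sub_mul]
    rw [integral_sub (integrable_snd_mul_evalAt hu r)
      (integrable_snd_mul_evalAt (continuous_toField v).continuousOn r), ← h2 r hr]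
    exact sub_self _

lemma pderiv_mem_lowDegree {n : ℕ} {q : Poly} (hq : q ∈ lowDegree (n + 1)) (i : Fin 2) :
    MvPolynomial.pderiv i q ∈ lowDegree n := by
  rw [mem_lowDegree_iff] at hq ⊢
  intro m hm
  rw [MvPolynomial.coeff_pderiv] at hm
  have := hq _ (left_ne_zero_of_mul hm)
  fin_cases i <;> simp at this <;> omega

lemma divPoly_curl (q : Poly) : divPoly (curl q) = 0 := by
  rw [divPoly, curl, map_neg, pderiv_comm, add_neg_cancel]

lemma divPoly_mem_lowDegree {k : ℕ} {v : Poly × Poly} (hv : v ∈ bdmSpace k) :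
    divPoly v ∈ lowDegree k := by
  obtain ⟨p, q, a, b, hp, hq, rfl⟩ := mem_bdmSpace_iff.1 hv
  have e : ∀ r s : Poly, divPoly ((p, q) + (a • curl r + b • curl s)) = divPoly (p, q) := by
    intro r s
    have h1 := divPoly_curl r
    have h2 := divPoly_curl s
    simp only [divPoly] at h1 h2 ⊢
    simp only [Prod.fst_add, Prod.snd_add, Prod.smul_fst, Prod.smul_snd, map_add,
      MvPolynomial.smul_eq_C_mul, MvPolynomial.pderiv_C_mul]
    linear_combination (exp := 1) MvPolynomial.C a * h1 + MvPolynomial.C b * h2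
  change divPoly ((p, q) + (a • curl _ + b • curl _)) ∈ _
  rw [e]
  exact Submodule.add_mem _ (pderiv_mem_lowDegree (mem_lowDegree_succ_iff.2 hp) 0)
    (pderiv_mem_lowDegree (mem_lowDegree_succ_iff.2 hq) 1)

/-- A polynomial of degree less than `n` that has the same moments as `f` up to that degree is
bounded by the `L¹` norm of `f`. The constant comes from a left inverse of the Gram map. -/
lemma exists_abs_evalAt_le (n : ℕ) :
    ∃ C : ℝ, 0 ≤ C ∧ ∀ (r : Poly) (f : ℝ × ℝ → ℝ), r ∈ lowDegree n →
      Integrable f squareMeasure →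
      (∀ q ∈ lowDegree n, polyInner r q = ∫ z, f z * evalAt z q ∂squareMeasure) →
      ∀ z ∈ refSquare, |evalAt z r| ≤ C * ∫ z, |f z| ∂squareMeasure := by
  let ι := {m : Fin 2 →₀ ℕ | m 0 + m 1 < n}
  let B := lowDegreeBasis n
  let G : lowDegree n →ₗ[ℝ] (ι → ℝ) :=
    LinearMap.pi fun i => polyInner.flip (B i : Poly) ∘ₗ (lowDegree n).subtype
  have hG : LinearMap.ker G = ⊥ := by
    rw [LinearMap.ker_eq_bot']
    intro r hr
    have h0 : polyInner (r : Poly) ∘ₗ (lowDegree n).subtype = 0 :=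
      B.ext fun i => congrFun hr i
    exact Subtype.ext (eq_zero_of_polyInner_self_eq_zero (LinearMap.congr_fun h0 r))
  obtain ⟨H, hH⟩ := G.exists_leftInverse_of_injective hG
  have hbd : ∀ q : Poly, ∃ M : ℝ, 0 ≤ M ∧ ∀ z ∈ refSquare, |evalAt z q| ≤ M := by
    intro q
    obtain ⟨M, hM⟩ := isCompact_refSquare.exists_bound_of_continuousOn
      (continuous_evalAt q).continuousOn
    have h0 : ((0 : ℝ), (0 : ℝ)) ∈ refSquare := by simp [refSquare]
    exact ⟨M, (norm_nonneg _).trans (hM _ h0), hM⟩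
  choose M hM0 hM using hbd
  classical
  refine ⟨∑ i : ι, M (B i) * M (H (Pi.single i 1)), Finset.sum_nonneg fun i _ =>
    mul_nonneg (hM0 _) (hM0 _), fun r f hr hf hmom z hz => ?_⟩
  have hcoef : ∀ i : ι, |polyInner r (B i)| ≤ M (B i) * ∫ z, |f z| ∂squareMeasure := by
    intro i
    rw [hmom _ (B i).2, ← integral_const_mul]
    refine abs_integral_le_integral_abs.trans (integral_mono_of_nonneg
      (.of_forall fun _ => abs_nonneg _) (hf.abs.const_mul _)
      (ae_mem_refSquare.mono fun z hz => ?_))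
    simp only
    rw [abs_mul, mul_comm]
    exact mul_le_mul_of_nonneg_right (hM _ z hz) (abs_nonneg _)
  have hr' : r = ∑ i : ι, polyInner r (B i) • (H (Pi.single i 1) : Poly) := by
    have h1 : H (G ⟨r, hr⟩) = ⟨r, hr⟩ := LinearMap.congr_fun hH ⟨r, hr⟩
    have h2 : G ⟨r, hr⟩ = ∑ i : ι, polyInner r (B i) • Pi.single i (1 : ℝ) := by
      rw [← pi_eq_sum_univ' (fun i : ι => polyInner r (B i))]
      rfl
    rw [h2, map_sum] at h1
    calc r = ((⟨r, hr⟩ : lowDegree n) : Poly) := rfl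
      _ = _ := by
        rw [← h1]
        simp
  have e : evalAt z r = ∑ i : ι, polyInner r (B i) * evalAt z (H (Pi.single i 1) : Poly) := by
    conv_lhs => rw [hr']
    simp [evalAt]
  rw [e, Finset.sum_mul]
  refine (Finset.abs_sum_le_sum_abs _ _).trans (Finset.sum_le_sum fun i _ => ?_)
  rw [abs_mul]
  calc _ ≤ (M (B i) * ∫ z, |f z| ∂squareMeasure) * M (H (Pi.single i 1)) :=
        mul_le_mul (hcoef i) (hM _ z hz) (abs_nonneg _)
          (mul_nonneg (hM0 _) (integral_nonneg fun _ => abs_nonneg _))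
    _ = _ := by ring

/-- The `L²` projection onto polynomials is quasi-optimal in `L^p`. -/
lemma exists_eLpNorm_sub_le_of_orthogonal (n : ℕ) {p : ℝ≥0∞} (hp : 1 ≤ p) :
    ∃ C : ℝ≥0, ∀ (w : ℝ × ℝ → ℝ) (d q : Poly), MemLp w p squareMeasure → d ∈ lowDegree n →
      q ∈ lowDegree n →
      (∀ r ∈ lowDegree n, ∫ z, (w z - evalAt z d) * evalAt z r ∂squareMeasure = 0) →
      eLpNorm (fun z => w z - evalAt z d) p squareMeasure ≤
        C * eLpNorm (fun z => w z - evalAt z q) p squareMeasure := by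
  obtain ⟨C, hC0, hC⟩ := exists_abs_evalAt_le n
  refine ⟨1 + C.toNNReal, fun w d q hw hd hq horth => ?_⟩
  set f : ℝ × ℝ → ℝ := fun z => w z - evalAt z q with hf
  have hfp : MemLp f p squareMeasure := hw.sub (memLp_evalAt q p)
  have hfi := hfp.integrable hp
  have hwd : Integrable (fun z => w z - evalAt z d) squareMeasure :=
    (hw.sub (memLp_evalAt d p)).integrable hp
  have hbd := hC (d - q) f (Submodule.sub_mem _ hd hq) hfi fun r hr => by
    have h0 := horth r hr
    have hrc := continuous_evalAt r
    rw [polyInner_apply, ← sub_zero (∫ z, f z * evalAt z r ∂squareMeasure), ← h0, ← integral_sub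
      (integrable_mul_continuous hfi hrc) (integrable_mul_continuous hwd hrc)]
    congr 1 with z
    rw [evalAt_sub, hf]
    ring
  have e : (fun z => w z - evalAt z d) = fun z => f z - evalAt z (d - q) := by
    ext z
    rw [evalAt_sub, hf]
    ring
  have h1 : eLpNorm (fun z => evalAt z (d - q)) p squareMeasure ≤
      C.toNNReal * eLpNorm f p squareMeasure := by
    calc _ ≤ eLpNorm (fun _ : ℝ × ℝ => C * ∫ z, |f z| ∂squareMeasure) p squareMeasure :=
          eLpNorm_mono_ae_real (ae_mem_refSquare.mono fun z hz => hbd z hz)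
      _ = C.toNNReal * eLpNorm f 1 squareMeasure := by
          rw [eLpNorm_const _ (zero_lt_one.trans_le hp).ne' (NeZero.ne _), measure_univ,
            ENNReal.one_rpow, mul_one, eLpNorm_one_eq_lintegral_enorm, enorm_mul,
            Real.enorm_of_nonneg hC0, Real.enorm_of_nonneg (integral_nonneg fun _ => abs_nonneg _),
            ← ofReal_integral_norm_eq_lintegral_enorm hfi]
          rfl
      _ ≤ _ := by
          gcongr
          exact eLpNorm_le_eLpNorm_of_exponent_le hp hfp.1
  rw [e]
  calc _ ≤ eLpNorm f p squareMeasure + eLpNorm (fun z => evalAt z (d - q)) p squareMeasure :=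
        eLpNorm_sub_le hfp.1 (memLp_evalAt _ p).1 hp
    _ ≤ eLpNorm f p squareMeasure + C.toNNReal * eLpNorm f p squareMeasure := by gcongr
    _ = _ := by
        push_cast
        ring

end BDM

theorem mainTheorem2 (k : ℕ) (hk : 1 ≤ k) :
    (∀ u : ℝ × ℝ → ℝ × ℝ, ContinuousOn u BDM.refSquare →
      ∃! v : BDM.Poly × BDM.Poly, BDM.IsBDMInterpolant k u v) ∧
    ∀ (ℓ : ℕ) (p : ℝ≥0∞), 1 ≤ ℓ → ℓ ≤ k → 1 ≤ p → p ≠ ∞ →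
      ∃ C : ℝ≥0, 0 < C ∧
        ∀ (u : ℝ × ℝ → ℝ × ℝ) (w : ℝ × ℝ → ℝ) (D : ℕ × ℕ → ℝ × ℝ → ℝ)
          (v : BDM.Poly × BDM.Poly),
          ContinuousOn u BDM.refSquare →
          BDM.HasWeakDiv u w →
          BDM.MemSobolev ℓ p w →
          (∀ α ∈ Finset.HasAntidiagonal.antidiagonal ℓ, BDM.HasWeakPartial α w (D α)) →
          BDM.IsBDMInterpolant k u v →
          BDM.HasWeakDiv (fun z => u z - BDM.toField v z)
              (fun z => w z - BDM.evalAt z (BDM.divPoly v)) ∧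
            eLpNorm (fun z => w z - BDM.evalAt z (BDM.divPoly v)) p BDM.squareMeasure ≤
              C * ∑ α ∈ Finset.HasAntidiagonal.antidiagonal ℓ, eLpNorm (D α) p BDM.squareMeasure := by
  refine ⟨fun u hu => BDM.existsUnique_isBDMInterpolant hk hu, fun ℓ p hℓ hℓk hp hp' => ?_⟩
  obtain ⟨C₁, hC₁⟩ := BDM.exists_eLpNorm_sub_evalAt_le hp hp' ℓ
  obtain ⟨C₂, hC₂⟩ := BDM.exists_eLpNorm_sub_le_of_orthogonal k hp
  refine ⟨C₂ * C₁ + 1, by positivity, fun u w D v hu hdiv hw hD hv => ?_⟩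
  have hwi := hw.1.integrable hp
  refine ⟨hdiv.sub_toField hu hwi v, ?_⟩
  by_cases htop : ∀ α ∈ Finset.HasAntidiagonal.antidiagonal ℓ, eLpNorm (D α) p BDM.squareMeasure < ∞
  · obtain ⟨E, hE, hE0, hED⟩ := hw.exists_isJet hℓ hp hD fun α hα =>
      ⟨(hD α hα).aestronglyMeasurable, htop α hα⟩
    obtain ⟨q, hq, hqE⟩ := hC₁ E hE
    have hqk : q ∈ BDM.lowDegree k := by
      rw [← Nat.sub_add_cancel hk, BDM.mem_lowDegree_succ_iff]
      exact hq _ (by omega)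
    rw [hE0, Finset.sum_congr rfl fun α hα => by rw [hED α hα]] at hqE
    calc _ ≤ C₂ * eLpNorm (fun z => w z - BDM.evalAt z q) p BDM.squareMeasure :=
          hC₂ w _ q hw.1 (BDM.divPoly_mem_lowDegree hv.1) hqk fun r hr =>
            hv.integral_div_mul_eq_zero hu hwi hdiv hr
      _ ≤ C₂ * (C₁ * ∑ α ∈ Finset.HasAntidiagonal.antidiagonal ℓ,
            eLpNorm (D α) p BDM.squareMeasure) := by gcongr
      _ ≤ _ := by
          rw [← mul_assoc]
          gcongr
          push_cast
          exact le_self_add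
  · -- if some derivative is not in `L^p`, the right-hand side is infinite
    push Not at htop
    obtain ⟨α, hα, hαt⟩ := htop
    have hsum : ∑ α ∈ Finset.HasAntidiagonal.antidiagonal ℓ,
        eLpNorm (D α) p BDM.squareMeasure = ∞ :=
      ENNReal.sum_eq_top.2 ⟨α, hα, top_le_iff.1 hαt⟩
    rw [hsum, ENNReal.mul_top (by positivity)]
    exact le_top
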